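/- **Setting.** Let $(\Omega,\mathcal F)$ be a measurable space with a filtration $(\mathcal F_t)_{t\ge 0}$, $\mathcal F_0=\{\emptyset,\Omega\}$, and let $S^1,\dots,S^d:[0,\infty)\times\Omega\to\mathbb R$ be adapted with all trajectories continuous. A *process* is an adapted map $[0,\infty)\times\Omega\to[-\infty,\infty]$. A sequence $(\tau_n)_{n\ge0}$ of $[0,\infty]$-valued stopping times is *proper* if $0=\tau_0\le\tau_1\le\cdots$ and for each $\omega$ the sequence $\tau_n(\omega)$ tends to $\infty$ or is eventually constant. A *simple trading strategy* $G=(c,(\tau_n),(g_n))$ consists of $c\in\mathbb R$, a proper sequence $(\tau_n)$ and bounded real $\mathcal F_{\tau_n}$-measurable $g_n$ with $g_n=0$ on $\{\tau_n=\infty\}$; put $(G\cdot S^j)_t=c+\sum_{n\ge1}g_{n-1}(S^j_{\tau_n\wedge t}-S^j_{\tau_{n-1}\wedge t})$. *Simple capital processes* are the sums $\sum_{j=1}^d G^j\cdot S^j$ with simple trading strategies $G^1,\dots,G^d$. Let $\mathcal C$ (*nonnegative supermartingales*) be the smallest class of maps $[0,\infty)\times\Omega\to[0,\infty]$ that contains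 all nonnegative simple capital processes, contains $X+Y$ whenever $X\in\mathcal C$, $Y$ is a simple capital process and $X+Y\ge0$, and contains $\liminf_n X^n$ whenever all $X^n\in\mathcal C$. A set (property) $E\subseteq[0,\infty)\times\Omega$ holds *with instant enforcement* (w.i.e.) if there is $X\in\mathcal C$ with $X_0=1$ and $X_t(\omega)=+\infty$ for all $(t,\omega)\notin E$; complements of such sets are *instantly blockable*. Assume that for every $t\ge0$ and every instantly blockable $B$ the projection of $B\cap([0,t]\times\Omega)$ onto $\Omega$ belongs to $\mathcal F_t$. Processes $Y^n$ converge to $Y$ *locally uniformly w.i.e.* if $\sup_{s\le t}|Y^n_s(\omega)-Y_s(\omega)|\to0$ holds w.i.e. as a property of $(t,\omega)$ (an undefined difference counts as infinite); for $\sigma:\Omega\to[0,\infty]$ they converge *locally uniformly on $[0,\sigma]\setminus\{\infty\}$ w.i.e.* if this holds with the supremum over $s\le t$, $s\le\sigma(\omega)$. *Martingales* form the smallest class of processes, real w.i.e., that contains all simple capital processes and contains every process $X$, real w.i.e., which is the locally uniform limit w.i.e. of a sequence of martingales. A sequence of stopping times $0=\tau_0\le\tau_1\le\cdots$ is a *fine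 cover w.i.e.* of $X$ with accuracy $\delta>0$ if, w.i.e. as a property of $(t,\omega)$, $X(\omega)$ is real on $[0,t]$, only finitely many $n$ satisfy $\tau_n(\omega)\le t$, and $\sup X(\omega)-\inf X(\omega)\le\delta$ on each interval $[\tau_n(\omega)\wedge t,\tau_{n+1}(\omega)\wedge t]$. Put $[X]^\tau_t=\sum_{n\ge1}(X_{\tau_n\wedge t}-X_{\tau_{n-1}\wedge t})^2$. A *quadratic variation* $[X]$ of a martingale $X$ is any process such that w.i.e. it is real and continuous on $[0,t]$, and such that for all $\delta_k>0$ with $\sum_k\delta_k<\infty$ and all fine covers w.i.e. $\tau^k$ of $X$ with accuracy $\delta_k$, the processes $[X]^{\tau^k}$ converge to $[X]$ locally uniformly w.i.e., and also locally uniformly w.i.e. on $[0,\sigma_M]\setminus\{\infty\}$ for every real $M>0$, where $\sigma_M=\inf\{t:|X_t|\ge M\}$. **Statement.** If $X$ is a martingale with $X_0=0$, and $[X]$ is a quadratic variation of $X$ with $[X]=0$ w.i.e. (i.e. $\{(t,\omega):[X]_t(\omega)=0\}$ is instantly enforceable), then $X=0$ w.i.e. (i.e. $\{(t,\omega):X_t(\omega)=0\}$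 is instantly enforceable). -/

import Mathlib

open MeasureTheory Filter Topology Set
open scoped NNReal ENNReal

namespace ModelFree

variable {Ω : Type*} {m : MeasurableSpace Ω} {d : ℕ}

/-- A non-decreasing sequence of stopping times (with values in `[0, +∞]`) starting from `0`. -/
structure IsStoppingSequence (ℱ : Filtration ℝ≥0 m) (τ : ℕ → Ω → WithTop ℝ≥0) : Prop where
  isStoppingTime : ∀ n, IsStoppingTime ℱ (τ n)
  mono : ∀ n ω, τ n ω ≤ τ (n + 1) ω
  zero : ∀ ω, τ 0 ω = 0

/-- A proper sequence of stopping times: for each `ω`, the sequence `τ n ω` diverges to `+∞` or is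
eventually constant. -/
structure IsProper (ℱ : Filtration ℝ≥0 m) (τ : ℕ → Ω → WithTop ℝ≥0) : Prop
    extends IsStoppingSequence ℱ τ where
  proper : ∀ ω, (∀ T : ℝ≥0, ∀ᶠ n in atTop, (T : WithTop ℝ≥0) < τ n ω) ∨
    ∃ n, ∀ k, n ≤ k → τ k ω = τ n ω

/-- A simple trading strategy `(c, (τ n), (g n))`. -/
structure SimpleStrategy (ℱ : Filtration ℝ≥0 m) where
  /-- the initial capital -/
  c : ℝ
  /-- the times of the trades -/
  τ : ℕ → Ω → WithTop ℝ≥0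
  /-- the position held between the times `τ n` and `τ (n + 1)` -/
  g : ℕ → Ω → ℝ
  isProper : IsProper ℱ τ
  bounded : ∀ n, ∃ K : ℝ, ∀ ω, |g n ω| ≤ K
  measurable : ∀ n, Measurable[(isProper.isStoppingTime n).measurableSpace] (g n)
  eq_zero : ∀ n ω, τ n ω = ⊤ → g n ω = 0

/-- The process `(G · X)_t = c + ∑ₙ gₙ (X_{τₙ₊₁ ∧ t} - X_{τₙ ∧ t})`; for every `t` and `ω` only
finitely many terms of the sum are nonzero. -/
noncomputable def SimpleStrategy.integral {ℱ : Filtration ℝ≥0 m} (G : SimpleStrategy ℱ)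
    (X : ℝ≥0 → Ω → ℝ) (t : ℝ≥0) (ω : Ω) : ℝ :=
  G.c + ∑' n, G.g n ω *
    (stoppedProcess X (G.τ (n + 1)) t ω - stoppedProcess X (G.τ n) t ω)

/-- Simple capital processes with respect to the basic martingales `S j`. -/
def IsSimpleCapital (ℱ : Filtration ℝ≥0 m) (S : Fin d → ℝ≥0 → Ω → ℝ)
    (Y : ℝ≥0 → Ω → ℝ) : Prop :=
  ∃ G : Fin d → SimpleStrategy ℱ, ∀ t ω, Y t ω = ∑ j, (G j).integral (S j) t ω

/-- The class of nonnegative supermartingales: the smallest class which contains all nonnegative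
simple capital processes, is closed under adding simple capital processes as long as the sum is
nonnegative, and is closed under `liminf` of sequences. -/
inductive NonnegSupermartingale (ℱ : Filtration ℝ≥0 m) (S : Fin d → ℝ≥0 → Ω → ℝ) :
    (ℝ≥0 → Ω → EReal) → Prop
  | capital (Y : ℝ≥0 → Ω → ℝ) (hY : IsSimpleCapital ℱ S Y) (h0 : ∀ t ω, 0 ≤ Y t ω) :
      NonnegSupermartingale ℱ S (fun t ω => (Y t ω : EReal))
  | add (X : ℝ≥0 → Ω → EReal) (Y : ℝ≥0 → Ω → ℝ) (hX : NonnegSupermartingale ℱ S X)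
      (hY : IsSimpleCapital ℱ S Y) (h0 : ∀ t ω, 0 ≤ X t ω + (Y t ω : EReal)) :
      NonnegSupermartingale ℱ S (fun t ω => X t ω + (Y t ω : EReal))
  | liminf (X : ℕ → ℝ≥0 → Ω → EReal) (hX : ∀ n, NonnegSupermartingale ℱ S (X n)) :
      NonnegSupermartingale ℱ S (fun t ω => Filter.liminf (fun n => X n t ω) atTop)

/-- The property `E` of pairs `(t, ω)` is instantly enforceable, i.e. it holds with instant
enforcement (w.i.e.). -/
def InstantlyEnforceable (ℱ : Filtration ℝ≥0 m) (S : Fin d → ℝ≥0 → Ω → ℝ)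
    (E : Set (ℝ≥0 × Ω)) : Prop :=
  ∃ X : ℝ≥0 → Ω → EReal, NonnegSupermartingale ℱ S X ∧ (∀ ω, X 0 ω = 1) ∧
    ∀ t ω, (t, ω) ∉ E → X t ω = ⊤

/-- Complements of instantly enforceable sets. -/
def InstantlyBlockable (ℱ : Filtration ℝ≥0 m) (S : Fin d → ℝ≥0 → Ω → ℝ)
    (B : Set (ℝ≥0 × Ω)) : Prop :=
  InstantlyEnforceable ℱ S Bᶜ

/-- Assumption A: for every instantly blockable `B` the projection of `B ∩ ([0, t] × Ω)` onto `Ω`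
belongs to `ℱ t`. -/
def AssumptionA (ℱ : Filtration ℝ≥0 m) (S : Fin d → ℝ≥0 → Ω → ℝ) : Prop :=
  ∀ (t : ℝ≥0) (B : Set (ℝ≥0 × Ω)), InstantlyBlockable ℱ S B →
    MeasurableSet[ℱ t] (Prod.snd '' (B ∩ (Iic t ×ˢ univ)))

/-- The extended real number is finite. -/
def IsReal (x : EReal) : Prop := x ≠ ⊤ ∧ x ≠ ⊥

/-- `sup_{s ∈ [0, t], p s} |Y_s(ω) - Z_s(ω)|`. Since `⊤ - ⊤ = ⊥ - ⊥ = ⊥` in `EReal` and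
`EReal.abs ⊥ = ⊤`, this is `+∞` if the difference is infinite or undefined for some such `s`. -/
noncomputable def supDist (Y Z : ℝ≥0 → Ω → EReal) (p : ℝ≥0 → Prop) (t : ℝ≥0) (ω : Ω) : ℝ≥0∞ :=
  ⨆ (s : ℝ≥0) (_ : s ≤ t) (_ : p s), (Y s ω - Z s ω).abs

/-- Locally uniform convergence with instant enforcement. -/
def TendstoLocUnifWIE (ℱ : Filtration ℝ≥0 m) (S : Fin d → ℝ≥0 → Ω → ℝ)
    (Y : ℕ → ℝ≥0 → Ω → EReal) (Z : ℝ≥0 → Ω → EReal) : Prop :=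
  InstantlyEnforceable ℱ S
    {q | Tendsto (fun n => supDist (Y n) Z (fun _ => True) q.1 q.2) atTop (𝓝 0)}

/-- Locally uniform convergence on the random interval `[0, σ] \ {+∞}` with instant
enforcement. -/
def TendstoLocUnifOnWIE (ℱ : Filtration ℝ≥0 m) (S : Fin d → ℝ≥0 → Ω → ℝ)
    (σ : Ω → ℝ≥0∞) (Y : ℕ → ℝ≥0 → Ω → EReal) (Z : ℝ≥0 → Ω → EReal) : Prop :=
  InstantlyEnforceable ℱ S
    {q | Tendsto (fun n => supDist (Y n) Z (fun s => (s : ℝ≥0∞) ≤ σ q.2) q.1 q.2) atTop (𝓝 0)}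

/-- Martingales: the smallest class of adapted, real w.i.e. processes which contains all simple
capital processes and is closed under locally uniform convergence w.i.e. -/
inductive IsMartingale (ℱ : Filtration ℝ≥0 m) (S : Fin d → ℝ≥0 → Ω → ℝ) :
    (ℝ≥0 → Ω → EReal) → Prop
  | capital (Y : ℝ≥0 → Ω → ℝ) (hY : IsSimpleCapital ℱ S Y) :
      IsMartingale ℱ S (fun t ω => (Y t ω : EReal))
  | lim (X : ℝ≥0 → Ω → EReal) (Xn : ℕ → ℝ≥0 → Ω → EReal) (hXn : ∀ n, IsMartingale ℱ S (Xn n))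
      (hX : Adapted ℱ X) (hreal : InstantlyEnforceable ℱ S {q | IsReal (X q.1 q.2)})
      (hlim : TendstoLocUnifWIE ℱ S Xn X) :
      IsMartingale ℱ S X

/-- The simple quadratic variation `∑ₙ (X_{τₙ₊₁ ∧ t} - X_{τₙ ∧ t})²` of `X` along `τ`. -/
noncomputable def simpleQV (X : ℝ≥0 → Ω → EReal) (τ : ℕ → Ω → WithTop ℝ≥0)
    (t : ℝ≥0) (ω : Ω) : EReal :=
  ((∑' n, (stoppedProcess X (τ (n + 1)) t ω - stoppedProcess X (τ n) t ω).abs ^ 2 : ℝ≥0∞) : EReal)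

/-- The pairs `(t, ω)` at which `τ` covers the path of `X` up to `t` with accuracy `δ`: the path is
real on `[0, t]`, finitely many of the times `τ n` are at most `t`, and the oscillation of `X` on
every interval `[τₙ ∧ t, τₙ₊₁ ∧ t]` is at most `δ`. -/
def fineCoverSet (X : ℝ≥0 → Ω → EReal) (δ : ℝ) (τ : ℕ → Ω → WithTop ℝ≥0) : Set (ℝ≥0 × Ω) :=
  {q | (∀ s ≤ q.1, IsReal (X s q.2)) ∧ {n | τ n q.2 ≤ (q.1 : WithTop ℝ≥0)}.Finite ∧
    ∀ n,
      (⨆ (s : ℝ≥0) (_ : min (τ n q.2) (q.1 : WithTop ℝ≥0) ≤ (s : WithTop ℝ≥0) ∧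
          (s : WithTop ℝ≥0) ≤ min (τ (n + 1) q.2) (q.1 : WithTop ℝ≥0)), X s q.2) -
        (⨅ (s : ℝ≥0) (_ : min (τ n q.2) (q.1 : WithTop ℝ≥0) ≤ (s : WithTop ℝ≥0) ∧
          (s : WithTop ℝ≥0) ≤ min (τ (n + 1) q.2) (q.1 : WithTop ℝ≥0)), X s q.2)
      ≤ (δ : EReal)}

/-- The sequence of stopping times `τ` is a fine cover of `X` with accuracy `δ` w.i.e. -/
def IsFineCoverWIE (ℱ : Filtration ℝ≥0 m) (S : Fin d → ℝ≥0 → Ω → ℝ)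
    (X : ℝ≥0 → Ω → EReal) (δ : ℝ) (τ : ℕ → Ω → WithTop ℝ≥0) : Prop :=
  IsStoppingSequence ℱ τ ∧
    ∃ E : Set (ℝ≥0 × Ω), InstantlyEnforceable ℱ S E ∧ E ⊆ fineCoverSet X δ τ

/-- `σ(X, M) = inf {t : |X_t| ≥ M}`, with `inf ∅ = +∞`. -/
noncomputable def exitTime (X : ℝ≥0 → Ω → EReal) (M : ℝ) (ω : Ω) : ℝ≥0∞ :=
  ⨅ (t : ℝ≥0) (_ : ENNReal.ofReal M ≤ (X t ω).abs), (t : ℝ≥0∞)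

/-- `Q` is a quadratic variation `[X]` of `X`: an adapted process, real and continuous w.i.e., to
which the simple quadratic variations of `X` converge along all sequences of fine covers w.i.e. with
summable accuracies. -/
structure IsQuadraticVariation (ℱ : Filtration ℝ≥0 m) (S : Fin d → ℝ≥0 → Ω → ℝ)
    (X Q : ℝ≥0 → Ω → EReal) : Prop where
  adapted : Adapted ℱ Q
  continuous : InstantlyEnforceable ℱ S
    {q | (∀ s ≤ q.1, IsReal (Q s q.2)) ∧ ContinuousOn (fun s => Q s q.2) (Iic q.1)}
  tendsto : ∀ (δ : ℕ → ℝ) (τ : ℕ → ℕ → Ω → WithTop ℝ≥0), (∀ k, 0 < δ k) → Summable δ →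
    (∀ k, IsFineCoverWIE ℱ S X (δ k) (τ k)) →
    (∀ M : ℝ, 0 < M →
      TendstoLocUnifOnWIE ℱ S (exitTime X M) (fun k => simpleQV X (τ k)) Q) ∧
    TendstoLocUnifWIE ℱ S (fun k => simpleQV X (τ k)) Q

end ModelFree

open MeasureTheory Filter Topology Set
open scoped NNReal ENNReal

namespace ModelFree

/-! Let `x` be a real version of the martingale, with `x 0 = 0`. Along stopping times `τ n`, the
square of `x` equals the sum of the gains from holding `2 * x` at `τ n` until `τ (n + 1)`, plus the
sum of squared increments. A trader who starts with `ε` and holds these positions owns `ε + x ^ 2`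
minus the squared increments. This stays nonnegative while their sum is at most `ε`, and then
dominates `x ^ 2` (`exists_square_hedge`). Since the quadratic variation vanishes, fine enough
covers keep the sum below any `ε`, so `x ^ 2` is superhedged from each capital `1 / (j + 1)`.
Multiplying by `j + 1` and taking the liminf gives a supermartingale that starts at 1 and is
infinite wherever `x ≠ 0` (`InstantlyEnforceable.of_hedges`).

The difficulty is that a martingale is not a capital process but an iterated limit of such
processes. What the argument needs is only `Tradable`: gains from trading in `x` can be superhedged
at no extra initial cost. This holds for simple capital processes (`IsSimpleCapital.tradable`) and
passes to limits (`Tradable.of_tendsto`), by stopping when the approximation error gets large;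
`IsMartingale.exists_version` collects the result.

The stopping times come from `exists_hitting`. There the filtration need not be right-continuous and
paths are continuous only while an enforceable property lasts; Assumption A makes that property
observable. -/

variable {Ω : Type*} {m : MeasurableSpace Ω} {d : ℕ}

variable {ℱ : Filtration ℝ≥0 m} {S : Fin d → ℝ≥0 → Ω → ℝ}

/-! ### Capped times and measurability at a minimum of stopping times -/

/-- The time `min t τ`, as a nonnegative real number. -/
noncomputable def cap (t : ℝ≥0) (τ : WithTop ℝ≥0) : ℝ≥0 := (min (t : WithTop ℝ≥0) τ).untopA

theorem coe_cap (t : ℝ≥0) (τ : WithTop ℝ≥0) :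
    (cap t τ : WithTop ℝ≥0) = min (t : WithTop ℝ≥0) τ := by
  unfold cap
  have h : min (t : WithTop ℝ≥0) τ ≠ ⊤ := ne_top_of_le_ne_top WithTop.coe_ne_top (min_le_left _ _)
  rw [WithTop.untopA_eq_untop h, WithTop.coe_untop]

theorem cap_le (t : ℝ≥0) (τ : WithTop ℝ≥0) : cap t τ ≤ t := by
  have : (cap t τ : WithTop ℝ≥0) ≤ t := by rw [coe_cap]; exact min_le_left _ _
  exact_mod_cast this

theorem coe_cap_le (t : ℝ≥0) (τ : WithTop ℝ≥0) : (cap t τ : WithTop ℝ≥0) ≤ τ := by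
  rw [coe_cap]; exact min_le_right _ _

theorem cap_of_le {t : ℝ≥0} {τ : WithTop ℝ≥0} (h : (t : WithTop ℝ≥0) ≤ τ) : cap t τ = t := by
  have : (cap t τ : WithTop ℝ≥0) = t := by rw [coe_cap, min_eq_left h]
  exact_mod_cast this

theorem coe_cap_of_ge {t : ℝ≥0} {τ : WithTop ℝ≥0} (h : τ ≤ (t : WithTop ℝ≥0)) :
    (cap t τ : WithTop ℝ≥0) = τ := by
  rw [coe_cap, min_eq_right h]

theorem cap_mono_left {s t : ℝ≥0} (h : s ≤ t) (τ : WithTop ℝ≥0) : cap s τ ≤ cap t τ := by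
  have : (cap s τ : WithTop ℝ≥0) ≤ cap t τ := by
    rw [coe_cap, coe_cap]; exact min_le_min_right _ (by exact_mod_cast h)
  exact_mod_cast this

theorem cap_mono_right (t : ℝ≥0) {σ τ : WithTop ℝ≥0} (h : σ ≤ τ) : cap t σ ≤ cap t τ := by
  have : (cap t σ : WithTop ℝ≥0) ≤ cap t τ := by
    rw [coe_cap, coe_cap]; exact min_le_min_left _ h
  exact_mod_cast this

theorem cap_cap (t : ℝ≥0) (σ τ : WithTop ℝ≥0) : cap (cap t σ) τ = cap t (min σ τ) := by
  have : (cap (cap t σ) τ : WithTop ℝ≥0) = cap t (min σ τ) := by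
    rw [coe_cap, coe_cap, coe_cap, min_assoc]
  exact_mod_cast this

theorem cap_eq_cap_of_le {t T : ℝ≥0} {τ : WithTop ℝ≥0} (h : τ ≤ t) (hT : t ≤ T) :
    cap T τ = cap t τ := by
  have : (cap T τ : WithTop ℝ≥0) = cap t τ := by
    rw [coe_cap_of_ge h, coe_cap_of_ge (h.trans (by exact_mod_cast hT))]
  exact_mod_cast this

theorem cap_zero (t : ℝ≥0) : cap t 0 = 0 := by
  have : (cap t 0 : WithTop ℝ≥0) = 0 := coe_cap_of_ge (WithTop.coe_le_coe.2 bot_le)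
  exact_mod_cast this

theorem zero_cap (τ : WithTop ℝ≥0) : cap 0 τ = 0 := le_antisymm (cap_le _ _) bot_le

theorem cap_top (t : ℝ≥0) : cap t ⊤ = t := cap_of_le le_top

theorem stoppedProcess_apply {β : Type*} (X : ℝ≥0 → Ω → β) (τ : Ω → WithTop ℝ≥0) (t : ℝ≥0)
    (ω : Ω) : stoppedProcess X τ t ω = X (cap t (τ ω)) ω := rfl

theorem continuous_cap (τ : WithTop ℝ≥0) : Continuous fun t => cap t τ := by
  induction τ with
  | top => simpa only [cap_top] using continuous_id'
  | coe a =>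
    have : (fun t => cap t (a : WithTop ℝ≥0)) = fun t => min t a := by
      ext1 t
      have : (cap t a : WithTop ℝ≥0) = (min t a : ℝ≥0) := by rw [coe_cap]; rfl
      exact_mod_cast this
    rw [this]
    fun_prop

/-- The change of a path over the part of `(a, b]` lying between `u` and `v`. -/
theorem restrict_increment (F : ℝ≥0 → ℝ) (t : ℝ≥0) {a b u v : WithTop ℝ≥0} (hab : a ≤ b)
    (huv : u ≤ v) :
    (if max a u < v then F (cap t (min (max b u) v)) - F (cap t (min (max a u) v)) else 0) =
      (F (cap (cap t v) b) - F (cap (cap t v) a)) -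
        (F (cap (cap t u) b) - F (cap (cap t u) a)) := by
  -- Clamping `a` to `[u, v]` splits into values stopped at `a` plus a term free of `a`, which
  -- cancels in the increment.
  have key : ∀ a : WithTop ℝ≥0, F (cap t (min (max a u) v)) =
      F (cap (cap t v) a) - F (cap (cap t u) a) + F (cap t u) := by
    intro a
    rw [cap_cap, cap_cap]
    rcases le_total a u with h | h
    · rw [max_eq_right h, min_eq_left huv, min_eq_right (h.trans huv), min_eq_right h]; ring
    · rw [max_eq_left h, min_eq_left h, min_comm]; ring
  split_ifs with h
  · rw [key, key]; ring
  · rw [cap_cap, cap_cap, cap_cap, cap_cap]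
    rcases le_max_iff.1 (not_lt.1 h) with h | h
    · rw [min_eq_left h, min_eq_left (h.trans hab), min_eq_left (huv.trans h),
        min_eq_left (huv.trans (h.trans hab))]; ring
    · rw [le_antisymm huv h]; ring

theorem measurableSet_stopping_lt {ρ π : Ω → WithTop ℝ≥0} (hρ : IsStoppingTime ℱ ρ)
    (hπ : IsStoppingTime ℱ π) : MeasurableSet[(hρ.min hπ).measurableSpace] {ω | ρ ω < π ω} := by
  have h : MeasurableSet[(hρ.min hπ).measurableSpace] {ω | π ω ≤ ρ ω} := by
    have := hπ.measurableSet_stopping_time_le_min hρ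
    rw [IsStoppingTime.measurableSet_min_iff hπ hρ] at this
    rw [IsStoppingTime.measurableSet_min_iff hρ hπ]
    exact this.symm
  convert! h.compl using 1
  ext ω; simp

/-- A position chosen at `ρ` and cancelled unless `ρ < π` is already known at `min ρ π`; this allows
a trade to be stopped at `π`. -/
theorem measurable_indicator_stopping_lt {ρ π : Ω → WithTop ℝ≥0} (hρ : IsStoppingTime ℱ ρ)
    (hπ : IsStoppingTime ℱ π) {f : Ω → ℝ} (hf : Measurable[hρ.measurableSpace] f) :
    Measurable[(hρ.min hπ).measurableSpace] ({ω | ρ ω < π ω}.indicator f) := by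
  intro s hs
  have hA := measurableSet_stopping_lt hρ hπ
  have h1 := (hρ.measurableSet_inter_le hπ _ (hf hs)).inter hA
  have : {ω | ρ ω < π ω}.indicator f ⁻¹' s =
      (f ⁻¹' s ∩ {ω | ρ ω ≤ π ω} ∩ {ω | ρ ω < π ω}) ∪
        ({ω | ρ ω < π ω}ᶜ ∩ {_ω | (0 : ℝ) ∈ s}) := by
    ext ω
    by_cases h : ρ ω < π ω
    · simp [h, h.le]
    · simp [h]
  rw [this]
  exact h1.union (hA.compl.inter (@MeasurableSet.const _ (hρ.min hπ).measurableSpace _))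

/-! ### Integrals of simple strategies -/

namespace SimpleStrategy

/-- The `n`-th summand of the integral of a simple strategy. -/
noncomputable def term (G : SimpleStrategy ℱ) (X : ℝ≥0 → Ω → ℝ) (t : ℝ≥0) (ω : Ω) (n : ℕ) : ℝ :=
  G.g n ω * (X (cap t (G.τ (n + 1) ω)) ω - X (cap t (G.τ n ω)) ω)

theorem integral_eq (G : SimpleStrategy ℱ) (X : ℝ≥0 → Ω → ℝ) (t : ℝ≥0) (ω : Ω) :
    G.integral X t ω = G.c + ∑' n, G.term X t ω n := rfl

/-- One `N` serves all `t ≤ T`, so the series is locally in time a fixed finite sum; continuity of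
the integral rests on this. -/
theorem exists_term_eq_zero (G : SimpleStrategy ℱ) (X : ℝ≥0 → Ω → ℝ) (T : ℝ≥0) (ω : Ω) :
    ∃ N, ∀ n, N ≤ n → ∀ t ≤ T, G.term X t ω n = 0 := by
  rcases G.isProper.proper ω with h | ⟨N, h⟩
  · obtain ⟨N, hN⟩ := eventually_atTop.1 (h T)
    refine ⟨N, fun n hn t ht => ?_⟩
    have ht' : (t : WithTop ℝ≥0) ≤ T := by exact_mod_cast ht
    rw [term, cap_of_le (ht'.trans (hN n hn).le), cap_of_le (ht'.trans (hN (n + 1) (by omega)).le)]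
    ring
  · refine ⟨N, fun n hn t _ => ?_⟩
    rw [term, h n hn, h (n + 1) (by omega)]
    ring

theorem summable_term (G : SimpleStrategy ℱ) (X : ℝ≥0 → Ω → ℝ) (t : ℝ≥0) (ω : Ω) :
    Summable (G.term X t ω) := by
  obtain ⟨N, hN⟩ := G.exists_term_eq_zero X t ω
  refine summable_of_ne_finset_zero (s := Finset.range N) fun n hn => ?_
  exact hN n (by simpa using hn) t le_rfl

/-- The strategy that takes the position of `G`, multiplied by `g`, between `τ` and `τ'`. -/
noncomputable def transform (G : SimpleStrategy ℱ) (c : ℝ) {τ τ' : Ω → WithTop ℝ≥0}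
    (hτ : IsStoppingTime ℱ τ) (hτ' : IsStoppingTime ℱ τ') {g : Ω → ℝ}
    (hg : Measurable[hτ.measurableSpace] g) {K : ℝ} (hK : ∀ ω, |g ω| ≤ K) :
    SimpleStrategy ℱ where
  c := c
  -- An idle trade at time 0 is prefixed because the clamped times need not start at 0.
  τ n := match n with
    | 0 => fun _ => 0
    | n + 1 => fun ω => min (max (G.τ n ω) (τ ω)) (τ' ω)
  -- Dropping the empty intervals gives measurability at the minimum and a zero position at time
  -- `⊤`.
  g n := match n with
    | 0 => fun _ => 0
    | n + 1 => {ω | max (G.τ n ω) (τ ω) < τ' ω}.indicator fun ω => g ω * G.g n ω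
  isProper :=
    { isStoppingTime := fun n => match n with
        | 0 => isStoppingTime_const ℱ (0 : ℝ≥0)
        | n + 1 => ((G.isProper.isStoppingTime n).max hτ).min hτ'
      mono := fun n ω => match n with
        | 0 => by simp
        | n + 1 => min_le_min_right _ (max_le_max_right _ (G.isProper.mono n ω))
      zero := fun _ => rfl
      proper := fun ω => by
        rcases G.isProper.proper ω with h | ⟨N, h⟩
        · rcases eq_or_ne (τ' ω) ⊤ with h' | h'
          · left
            intro T
            obtain ⟨N, hN⟩ := eventually_atTop.1 (h T)
            refine eventually_atTop.2 ⟨N + 1, fun n hn => ?_⟩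
            obtain ⟨k, rfl⟩ : ∃ k, n = k + 1 := ⟨n - 1, by omega⟩
            simp only [h', le_top, inf_of_le_left]
            exact lt_max_of_lt_left (hN k (by omega))
          · right
            obtain ⟨T, hT⟩ := WithTop.ne_top_iff_exists.1 h'
            obtain ⟨N, hN⟩ := eventually_atTop.1 (h T)
            have hmin : ∀ k, N + 1 ≤ k → ∃ j, k = j + 1 ∧ τ' ω ≤ max (G.τ j ω) (τ ω) := by
              intro k hk
              refine ⟨k - 1, by omega, ?_⟩
              rw [← hT]
              exact le_max_of_le_left (hN (k - 1) (by omega)).le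
            refine ⟨N + 1, fun k hk => ?_⟩
            obtain ⟨j, rfl, hj⟩ := hmin k hk
            have hN' := hN N le_rfl
            simp only [min_eq_right hj]
            rw [min_eq_right]
            rw [← hT]
            exact le_max_of_le_left hN'.le
        · right
          refine ⟨N + 1, fun k hk => ?_⟩
          obtain ⟨j, rfl⟩ : ∃ j, k = j + 1 := ⟨k - 1, by omega⟩
          simp only [h j (by omega)] }
  bounded := fun n => match n with
    | 0 => ⟨0, fun ω => by simp⟩
    | n + 1 => by
      obtain ⟨B, hB⟩ := G.bounded n
      refine ⟨K * B, fun ω => ?_⟩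
      have hK0 := (abs_nonneg _).trans (hK ω)
      have hB0 := (abs_nonneg _).trans (hB ω)
      by_cases h : ω ∈ {ω | max (G.τ n ω) (τ ω) < τ' ω}
      · simp only [indicator_of_mem h, abs_mul]
        exact mul_le_mul (hK ω) (hB ω) (abs_nonneg _) hK0
      · simp only [indicator_of_notMem h, abs_zero]
        positivity
  measurable := fun n => match n with
    | 0 => measurable_const
    | n + 1 => by
      refine measurable_indicator_stopping_lt ((G.isProper.isStoppingTime n).max hτ) hτ' ?_
      refine Measurable.mul (hg.mono ?_ le_rfl) ((G.measurable n).mono ?_ le_rfl)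
      · exact IsStoppingTime.measurableSpace_mono _ _ fun ω => le_max_right _ _
      · exact IsStoppingTime.measurableSpace_mono _ _ fun ω => le_max_left _ _
  eq_zero := fun n ω => match n with
    | 0 => by simp
    | n + 1 => fun h => by
      refine indicator_of_notMem (fun h' => ?_) _
      have h' : max (G.τ n ω) (τ ω) < τ' ω := h'
      exact not_top_lt ((min_eq_top.1 h).1 ▸ h')

theorem transform_integral (G : SimpleStrategy ℱ) (c : ℝ) {τ τ' : Ω → WithTop ℝ≥0}
    (hτ : IsStoppingTime ℱ τ) (hτ' : IsStoppingTime ℱ τ') (hle : ∀ ω, τ ω ≤ τ' ω) {g : Ω → ℝ}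
    (hg : Measurable[hτ.measurableSpace] g) {K : ℝ} (hK : ∀ ω, |g ω| ≤ K)
    (X : ℝ≥0 → Ω → ℝ) (t : ℝ≥0) (ω : Ω) :
    (G.transform c hτ hτ' hg hK).integral X t ω =
      c + g ω * (G.integral X (cap t (τ' ω)) ω - G.integral X (cap t (τ ω)) ω) := by
  rw [integral_eq, (summable_term _ X t ω).tsum_eq_zero_add, integral_eq, integral_eq]
  have h0 : (G.transform c hτ hτ' hg hK).term X t ω 0 = 0 := by simp [term, transform]
  have h1 : ∀ n, (G.transform c hτ hτ' hg hK).term X t ω (n + 1) =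
      g ω * (G.term X (cap t (τ' ω)) ω n - G.term X (cap t (τ ω)) ω n) := by
    intro n
    have := restrict_increment (fun s => X s ω) t (G.isProper.mono n ω) (hle ω)
    simp only [term]
    rw [← mul_sub, ← this]
    by_cases h : max (G.τ n ω) (τ ω) < τ' ω
    · have h' : ω ∈ {ω | max (G.τ n ω) (τ ω) < τ' ω} := h
      simp only [transform, indicator_of_mem h', if_pos h, mul_assoc]
    · have h' : ω ∉ {ω | max (G.τ n ω) (τ ω) < τ' ω} := h
      simp only [transform, indicator_of_notMem h', if_neg h, mul_zero, zero_mul]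
  simp only [h0, h1]
  rw [tsum_mul_left, (summable_term G X _ ω).tsum_sub (summable_term G X _ ω)]
  simp only [transform]
  ring

end SimpleStrategy

theorem isStronglyProgressive_of_continuous {X : ℝ≥0 → Ω → ℝ} (hX : Adapted ℱ X)
    (hc : ∀ ω, Continuous fun t => X t ω) : IsStronglyProgressive ℱ X :=
  hX.stronglyAdapted.isStronglyProgressive_of_continuous hc

namespace SimpleStrategy

/-- The position `G.g n` matters at time `t` only if `G.τ n < t`, and on that event it is known at
time `t`. -/
theorem measurable_term (G : SimpleStrategy ℱ) {X : ℝ≥0 → Ω → ℝ} (hX : Adapted ℱ X)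
    (hc : ∀ ω, Continuous fun t => X t ω) (t : ℝ≥0) (n : ℕ) :
    Measurable[ℱ t] fun ω => G.term X t ω n := by
  have hp := isStronglyProgressive_of_continuous hX hc
  have h1 : ∀ k, Measurable[ℱ t] fun ω => X (cap t (G.τ k ω)) ω := fun k =>
    (hp.stronglyAdapted_stoppedProcess (G.isProper.isStoppingTime k) t).measurable
  have h2 : Measurable[ℱ t] ({ω | G.τ n ω < t}.indicator (G.g n)) := by
    have := measurable_indicator_stopping_lt (G.isProper.isStoppingTime n)
      (isStoppingTime_const ℱ t) (G.measurable n)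
    refine this.mono ?_ le_rfl
    exact IsStoppingTime.measurableSpace_le_of_le_const _ fun ω => min_le_right _ _
  have h3 : (fun ω => G.term X t ω n) = fun ω => {ω | G.τ n ω < t}.indicator (G.g n) ω *
      (X (cap t (G.τ (n + 1) ω)) ω - X (cap t (G.τ n ω)) ω) := by
    ext ω
    by_cases h : G.τ n ω < t
    · have h' : ω ∈ {ω | G.τ n ω < t} := h
      rw [indicator_of_mem h']; rfl
    · have h' : ω ∉ {ω | G.τ n ω < t} := h
      rw [indicator_of_notMem h', term, cap_of_le (not_lt.1 h),
        cap_of_le ((not_lt.1 h).trans (G.isProper.mono n ω))]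
      ring
  rw [h3]
  exact h2.mul ((h1 _).sub (h1 _))

theorem adapted_integral (G : SimpleStrategy ℱ) {X : ℝ≥0 → Ω → ℝ} (hX : Adapted ℱ X)
    (hc : ∀ ω, Continuous fun t => X t ω) : Adapted ℱ (G.integral X) := by
  intro t
  refine Measurable.const_add (f := fun ω => ∑' n, G.term X t ω n) ?_ G.c
  exact @measurable_of_tendsto_metrizable Ω ℝ (ℱ t) _ _ _ _
    (fun N ω => ∑ n ∈ Finset.range N, G.term X t ω n) _
    (fun N => Finset.measurable_fun_sum _ fun n _ => G.measurable_term hX hc t n)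
    (tendsto_pi_nhds.2 fun ω => (G.summable_term X t ω).hasSum.tendsto_sum_nat)

theorem continuous_integral (G : SimpleStrategy ℱ) {X : ℝ≥0 → Ω → ℝ}
    (hc : ∀ ω, Continuous fun t => X t ω) (ω : Ω) : Continuous fun t => G.integral X t ω := by
  refine continuous_iff_continuousAt.2 fun t => ?_
  obtain ⟨N, hN⟩ := G.exists_term_eq_zero X (t + 1) ω
  have h : (fun s => G.integral X s ω) =ᶠ[𝓝 t]
      fun s => G.c + ∑ n ∈ Finset.range N, G.term X s ω n := by
    filter_upwards [Iio_mem_nhds (lt_add_one t)] with s hs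
    rw [integral_eq, tsum_eq_sum]
    intro n hn
    exact hN n (by simpa using hn) s (le_of_lt hs)
  refine ContinuousAt.congr (Continuous.continuousAt ?_) h.symm
  refine continuous_const.add (continuous_finsetSum _ fun n _ => ?_)
  exact continuous_const.mul (((hc ω).comp (continuous_cap _)).sub ((hc ω).comp (continuous_cap _)))

theorem integral_zero (G : SimpleStrategy ℱ) (X : ℝ≥0 → Ω → ℝ) (ω : Ω) :
    G.integral X 0 ω = G.c := by
  simp [integral_eq, term, zero_cap]

end SimpleStrategy

/-! ### Stability of simple capital processes -/

namespace IsSimpleCapital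

variable {Y : ℝ≥0 → Ω → ℝ}

theorem adapted (hY : IsSimpleCapital ℱ S Y) (hS : ∀ j, Adapted ℱ (S j))
    (hc : ∀ j ω, Continuous fun t => S j t ω) : Adapted ℱ Y := by
  obtain ⟨G, hG⟩ := hY
  intro t
  have : Y t = fun ω => ∑ j, (G j).integral (S j) t ω := funext (hG t)
  rw [this]
  exact Finset.measurable_fun_sum _ fun j _ => (G j).adapted_integral (hS j) (hc j) t

theorem continuous (hY : IsSimpleCapital ℱ S Y)
    (hc : ∀ j ω, Continuous fun t => S j t ω) (ω : Ω) : Continuous fun t => Y t ω := by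
  obtain ⟨G, hG⟩ := hY
  simp only [hG]
  exact continuous_finsetSum _ fun j _ => (G j).continuous_integral (hc j) ω

theorem exists_initial (hY : IsSimpleCapital ℱ S Y) : ∃ c, ∀ ω, Y 0 ω = c := by
  obtain ⟨G, hG⟩ := hY
  exact ⟨∑ j, (G j).c, fun ω => by simp [hG, SimpleStrategy.integral_zero]⟩

/-- Simple capital processes are stable under trading in them at two stopping times. -/
theorem transform (hY : IsSimpleCapital ℱ S Y) (j₀ : Fin d) (c : ℝ) {τ τ' : Ω → WithTop ℝ≥0}
    (hτ : IsStoppingTime ℱ τ) (hτ' : IsStoppingTime ℱ τ') (hle : ∀ ω, τ ω ≤ τ' ω) {g : Ω → ℝ}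
    (hg : Measurable[hτ.measurableSpace] g) {K : ℝ} (hK : ∀ ω, |g ω| ≤ K) :
    IsSimpleCapital ℱ S fun t ω => c + g ω * (Y (cap t (τ' ω)) ω - Y (cap t (τ ω)) ω) := by
  obtain ⟨G, hG⟩ := hY
  -- The whole initial capital `c` is booked on the asset `j₀`.
  refine ⟨fun j => (G j).transform (if j = j₀ then c else 0) hτ hτ' hg hK, fun t ω => ?_⟩
  simp only [hG, SimpleStrategy.transform_integral _ _ hτ hτ' hle hg hK, Finset.sum_add_distrib,
    ← Finset.mul_sum, Finset.sum_sub_distrib]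
  simp

theorem stopped (hY : IsSimpleCapital ℱ S Y) (j₀ : Fin d) {ρ : Ω → WithTop ℝ≥0}
    (hρ : IsStoppingTime ℱ ρ) : IsSimpleCapital ℱ S (stoppedProcess Y ρ) := by
  obtain ⟨c, hc⟩ := hY.exists_initial
  have h0 : IsStoppingTime ℱ fun _ : Ω => ((0 : ℝ≥0) : WithTop ℝ≥0) := isStoppingTime_const ℱ 0
  convert hY.transform j₀ c h0 hρ (fun ω => WithTop.coe_le_iff.2 fun _ _ => bot_le)
    (g := fun _ => 1) measurable_const (K := 1) (by simp) using 3 with t ω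
  have : cap t ((0 : ℝ≥0) : WithTop ℝ≥0) = 0 := cap_zero t
  rw [this, hc, stoppedProcess_apply]
  ring

theorem const_mul (hY : IsSimpleCapital ℱ S Y) (j₀ : Fin d) (a : ℝ) :
    IsSimpleCapital ℱ S fun t ω => a * Y t ω := by
  obtain ⟨c, hc⟩ := hY.exists_initial
  have h0 : IsStoppingTime ℱ fun _ : Ω => ((0 : ℝ≥0) : WithTop ℝ≥0) := isStoppingTime_const ℱ 0
  have h1 : IsStoppingTime ℱ fun _ : Ω => (⊤ : WithTop ℝ≥0) := fun t => by simp
  convert hY.transform j₀ (a * c) h0 h1 (fun ω => le_top)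
    (g := fun _ => a) measurable_const (K := |a|) (by simp) using 3 with t ω
  have : cap t ((0 : ℝ≥0) : WithTop ℝ≥0) = 0 := cap_zero t
  rw [this, hc, cap_top]
  ring

theorem const (ℱ : Filtration ℝ≥0 m) (S : Fin d → ℝ≥0 → Ω → ℝ) (j₀ : Fin d) (c : ℝ) :
    IsSimpleCapital ℱ S fun _ _ => c := by
  let G : SimpleStrategy ℱ :=
    { c := 0
      τ := fun _ _ => 0
      g := fun _ _ => 0
      isProper :=
        { isStoppingTime := fun _ => isStoppingTime_const ℱ (0 : ℝ≥0)
          mono := fun _ _ => le_rfl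
          zero := fun _ => rfl
          proper := fun _ => Or.inr ⟨0, fun _ _ => rfl⟩ }
      bounded := fun _ => ⟨0, fun _ => by simp⟩
      measurable := fun _ => measurable_const
      eq_zero := fun _ _ _ => rfl }
  have hG : IsSimpleCapital ℱ S fun t ω => ∑ j, G.integral (S j) t ω :=
    ⟨fun _ => G, fun _ _ => rfl⟩
  have h0 : IsStoppingTime ℱ fun _ : Ω => ((0 : ℝ≥0) : WithTop ℝ≥0) := isStoppingTime_const ℱ 0
  convert hG.transform j₀ c h0 h0 (fun _ => le_rfl) (g := fun _ => 0) measurable_const (K := 0)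
    (by simp) using 3
  simp

end IsSimpleCapital

/-! ### Stability of nonnegative supermartingales -/

namespace NonnegSupermartingale

variable {X Z : ℝ≥0 → Ω → EReal}

theorem nonneg (hX : NonnegSupermartingale ℱ S X) (t : ℝ≥0) (ω : Ω) : 0 ≤ X t ω := by
  induction hX with
  | capital Y _ h0 => exact EReal.coe_nonneg.2 (h0 t ω)
  | add X Y _ _ h0 _ => exact h0 t ω
  | liminf X _ ih => exact le_liminf_of_le (by isBoundedDefault) (Eventually.of_forall ih)

/-- Structural induction on `X` with `Z` fixed. Nonnegativity excludes `⊥`, so adding `Z` commutes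
with the liminf even where `Z` is `⊤`. -/
theorem add' (hX : NonnegSupermartingale ℱ S X) (hZ : NonnegSupermartingale ℱ S Z) :
    NonnegSupermartingale ℱ S fun t ω => X t ω + Z t ω := by
  induction hX with
  | capital Y hY h0 =>
    have h := hZ.add Z Y hY fun t ω => add_nonneg (hZ.nonneg t ω) (by exact_mod_cast h0 t ω)
    simpa only [add_comm] using h
  | add X Y hX hY h0 ih =>
    have e : ∀ t ω, X t ω + Y t ω + Z t ω = X t ω + Z t ω + Y t ω := fun t ω =>
      add_right_comm _ _ _
    have h := ih.add _ Y hY fun t ω => by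
      rw [← e]; exact add_nonneg (h0 t ω) (hZ.nonneg t ω)
    simpa only [e] using h
  | liminf X hX ih =>
    have h := NonnegSupermartingale.liminf _ ih
    convert! h using 3 with t ω
    have h0 : Filter.liminf (fun n => X n t ω) atTop ≠ ⊥ := by
      have := (NonnegSupermartingale.liminf X hX).nonneg t ω
      exact fun h => absurd (h ▸ this) (by simp)
    have hz : Z t ω ≠ ⊥ := fun h => absurd (h ▸ hZ.nonneg t ω) (by simp)
    refine le_antisymm ?_ ?_
    · have := EReal.le_liminf_add (f := atTop) (u := fun n => X n t ω) (v := fun _ => Z t ω)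
      rwa [liminf_const] at this
    · have := EReal.liminf_add_le (f := atTop) (u := fun _ : ℕ => Z t ω) (v := fun n => X n t ω)
        (Or.inl (by rwa [limsup_const])) (Or.inr h0)
      rw [limsup_const] at this
      refine le_trans (le_of_eq ?_) (this.trans (le_of_eq (add_comm _ _)))
      congr 1
      ext n
      exact add_comm _ _

theorem const_mul (hX : NonnegSupermartingale ℱ S X) (j₀ : Fin d) {a : ℝ} (ha : 0 ≤ a) :
    NonnegSupermartingale ℱ S fun t ω => (a : EReal) * X t ω := by
  have ha' : (0 : EReal) ≤ a := by exact_mod_cast ha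
  induction hX with
  | capital Y hY h0 =>
    have := NonnegSupermartingale.capital _ (hY.const_mul j₀ a) fun t ω => mul_nonneg ha (h0 t ω)
    simpa only [EReal.coe_mul] using this
  | add X Y hX hY h0 ih =>
    have e : ∀ t ω, (a : EReal) * (X t ω + Y t ω) = a * X t ω + ((a * Y t ω : ℝ) : EReal) :=
      fun t ω => by
        rw [EReal.left_distrib_of_nonneg_of_ne_top ha' (EReal.coe_ne_top a), EReal.coe_mul]
    have h := ih.add _ _ (hY.const_mul j₀ a) fun t ω => by
      rw [← e]; exact mul_nonneg ha' (h0 t ω)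
    simpa only [e] using h
  | liminf X hX ih =>
    have h := NonnegSupermartingale.liminf _ ih
    convert! h using 3 with t ω
    exact (EReal.liminf_const_mul_of_nonneg_of_ne_top ha' (EReal.coe_ne_top a)).symm

theorem stopped (hX : NonnegSupermartingale ℱ S X) (j₀ : Fin d) {ρ : Ω → WithTop ℝ≥0}
    (hρ : IsStoppingTime ℱ ρ) : NonnegSupermartingale ℱ S (stoppedProcess X ρ) := by
  induction hX with
  | capital Y hY h0 => exact .capital _ (hY.stopped j₀ hρ) fun t ω => h0 _ _
  | add X Y hX hY h0 ih => exact ih.add _ _ (hY.stopped j₀ hρ) fun t ω => h0 _ _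
  | liminf X hX ih => exact .liminf _ ih

theorem const (ℱ : Filtration ℝ≥0 m) (S : Fin d → ℝ≥0 → Ω → ℝ) (j₀ : Fin d) {c : ℝ}
    (hc : 0 ≤ c) : NonnegSupermartingale ℱ S fun _ _ => (c : EReal) :=
  .capital _ (.const ℱ S j₀ c) fun _ _ => hc

theorem finset_sum {ι : Type*} (s : Finset ι) {X : ι → ℝ≥0 → Ω → EReal} (j₀ : Fin d)
    (hX : ∀ i, NonnegSupermartingale ℱ S (X i)) :
    NonnegSupermartingale ℱ S fun t ω => ∑ i ∈ s, X i t ω := by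
  classical
  induction s using Finset.induction_on with
  | empty => simpa using const ℱ S j₀ le_rfl
  | insert i s hi ih =>
    simp only [Finset.sum_insert hi]
    exact (hX i).add' ih

end NonnegSupermartingale

/-! ### Calculus of enforceable properties -/

namespace InstantlyEnforceable

variable {E F : Set (ℝ≥0 × Ω)}

theorem mono (hE : InstantlyEnforceable ℱ S E) (h : E ⊆ F) : InstantlyEnforceable ℱ S F := by
  obtain ⟨V, hV, h1, h2⟩ := hE
  exact ⟨V, hV, h1, fun t ω hF => h2 t ω fun hE => hF (h hE)⟩

theorem univ (ℱ : Filtration ℝ≥0 m) (S : Fin d → ℝ≥0 → Ω → ℝ) (j₀ : Fin d) :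
    InstantlyEnforceable ℱ S univ :=
  ⟨_, .const ℱ S j₀ zero_le_one, fun _ => EReal.coe_one, fun _ _ h => (h (mem_univ _)).elim⟩

/-- The weights `(1 / 2) ^ (n + 1)` sum to 1, so the weighted sum of the enforcing supermartingales
starts at 1; it is infinite as soon as one summand is. -/
theorem iInter (j₀ : Fin d) {E : ℕ → Set (ℝ≥0 × Ω)} (hE : ∀ n, InstantlyEnforceable ℱ S (E n)) :
    InstantlyEnforceable ℱ S (⋂ n, E n) := by
  choose V hV h1 h2 using hE
  have ha : ∀ n : ℕ, (0 : ℝ) < (1 / 2) ^ (n + 1) := fun n => by positivity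
  have hV' := fun n => (hV n).const_mul j₀ (ha n).le
  refine ⟨_, .liminf _ fun N => .finset_sum (Finset.range N) j₀ hV', fun ω => ?_, fun t ω h => ?_⟩
  · have hs : HasSum (fun n : ℕ => (1 / 2 : ℝ) ^ (n + 1)) 1 := by
      simpa [pow_succ', div_eq_mul_inv] using hasSum_geometric_two' 1
    have ht := hs.tendsto_sum_nat
    have ht' := (continuous_coe_real_ereal.tendsto (1 : ℝ)).comp ht
    rw [EReal.coe_one] at ht'
    refine Tendsto.liminf_eq (ht'.congr fun N => ?_)
    simp only [h1, mul_one, Function.comp]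
    induction N with
    | zero => simp
    | succ N ih => rw [Finset.sum_range_succ, Finset.sum_range_succ, EReal.coe_add, ih]
  · obtain ⟨n, hn⟩ : ∃ n, (t, ω) ∉ E n := by simpa using h
    refine top_le_iff.1 (le_liminf_of_le (by isBoundedDefault) ?_)
    filter_upwards [eventually_gt_atTop n] with N hN
    refine le_trans (le_of_eq ?_) (Finset.single_le_sum (fun i _ => (hV' i).nonneg t ω)
      (Finset.mem_range.2 hN))
    rw [h2 n t ω hn, EReal.coe_mul_top_of_pos (ha n)]

theorem inter (j₀ : Fin d) (hE : InstantlyEnforceable ℱ S E) (hF : InstantlyEnforceable ℱ S F) :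
    InstantlyEnforceable ℱ S (E ∩ F) := by
  refine (iInter j₀ (E := fun n => if n = 0 then E else F) fun n => ?_).mono fun q hq => ?_
  · split_ifs <;> assumption
  · rw [mem_iInter] at hq
    exact ⟨by simpa using hq 0, by simpa using hq 1⟩

/-- Without assets every capital process, hence every nonnegative supermartingale, is zero and
cannot start at 1. The index obtained serves to carry constants. -/
theorem exists_fin (hE : InstantlyEnforceable ℱ S E) [Nonempty Ω] : Nonempty (Fin d) := by
  obtain ⟨V, hV, h1, -⟩ := hE
  by_contra hd
  rw [not_nonempty_iff] at hd
  have h0 : ∀ t ω, V t ω = 0 := by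
    clear h1
    have hY : ∀ Y, IsSimpleCapital ℱ S Y → ∀ t ω, Y t ω = 0 := by
      rintro Y ⟨G, hG⟩ t ω
      rw [hG]
      simp
    induction hV with
    | capital Y h _ => intro t ω; simp [hY Y h]
    | add X Y _ h _ ih => intro t ω; simp [ih, hY Y h]
    | liminf X _ ih => intro t ω; simp [ih]
  obtain ⟨ω⟩ := ‹Nonempty Ω›
  exact zero_ne_one ((h0 0 ω).symm.trans (h1 ω))

end InstantlyEnforceable

/-- The property `E` is instantly enforceable, and at the times where it holds it has held at all
earlier times. -/
structure InitiallyEnforceable (ℱ : Filtration ℝ≥0 m) (S : Fin d → ℝ≥0 → Ω → ℝ)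
    (E : Set (ℝ≥0 × Ω)) : Prop where
  enforceable : InstantlyEnforceable ℱ S E
  initial : ∀ ⦃s t ω⦄, s ≤ t → (t, ω) ∈ E → (s, ω) ∈ E

namespace InitiallyEnforceable

variable {E F : Set (ℝ≥0 × Ω)}

theorem univ (ℱ : Filtration ℝ≥0 m) (S : Fin d → ℝ≥0 → Ω → ℝ) (j₀ : Fin d) :
    InitiallyEnforceable ℱ S univ := ⟨.univ ℱ S j₀, fun _ _ _ _ _ => mem_univ _⟩

theorem iInter (j₀ : Fin d) {E : ℕ → Set (ℝ≥0 × Ω)} (hE : ∀ n, InitiallyEnforceable ℱ S (E n)) :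
    InitiallyEnforceable ℱ S (⋂ n, E n) :=
  ⟨.iInter j₀ fun n => (hE n).enforceable, fun _ _ _ hst h =>
    mem_iInter.2 fun n => (hE n).initial hst (mem_iInter.1 h n)⟩

theorem inter (j₀ : Fin d) (hE : InitiallyEnforceable ℱ S E) (hF : InitiallyEnforceable ℱ S F) :
    InitiallyEnforceable ℱ S (E ∩ F) :=
  ⟨.inter j₀ hE.enforceable hF.enforceable, fun _ _ _ hst h =>
    ⟨hE.initial hst h.1, hF.initial hst h.2⟩⟩

/-- Since `E` is inherited by earlier times, it fails somewhere in `[0, t]` exactly when it fails at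
`t`, so Assumption A applies to its complement. -/
theorem measurableSet (hA : AssumptionA ℱ S) (hE : InitiallyEnforceable ℱ S E) (t : ℝ≥0) :
    MeasurableSet[ℱ t] {ω | (t, ω) ∈ E} := by
  have h := hA t Eᶜ (by rw [InstantlyBlockable, compl_compl]; exact hE.enforceable)
  convert! h.compl using 1
  ext ω
  simp only [mem_ofPred_eq, mem_compl_iff, mem_image, mem_inter_iff, mem_prod, mem_Iic, mem_univ,
    and_true, Prod.exists, exists_eq_right, not_exists, not_and, not_le]
  refine ⟨fun h s hs => ?_, fun h => ?_⟩
  · by_contra hst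
    exact hs (hE.initial (not_lt.1 hst) h)
  · by_contra ht
    exact lt_irrefl _ (h t ht)

end InitiallyEnforceable

/-! ### Progressive versions and hitting times -/

/-- The largest multiple of `1 / k` that is at most `t`. -/
noncomputable def floorDiv (k : ℕ) (t : ℝ≥0) : ℝ≥0 := (⌊(t : ℝ) * k⌋₊ : ℝ≥0) / k

theorem floorDiv_le (k : ℕ) (t : ℝ≥0) : floorDiv k t ≤ t := by
  rcases Nat.eq_zero_or_pos k with rfl | hk
  · simp [floorDiv]
  · have hk' : (0 : ℝ≥0) < k := by exact_mod_cast hk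
    rw [floorDiv, div_le_iff₀ hk']
    have : (⌊(t : ℝ) * k⌋₊ : ℝ) ≤ (t : ℝ) * k := Nat.floor_le (by positivity)
    exact_mod_cast this

theorem tendsto_floorDiv (t : ℝ≥0) : Tendsto (fun k => floorDiv k t) atTop (𝓝[≤] t) := by
  refine tendsto_nhdsWithin_iff.2 ⟨?_, Eventually.of_forall fun k => floorDiv_le k t⟩
  rw [← NNReal.tendsto_coe]
  refine ((tendsto_nat_floor_mul_div_atTop (NNReal.coe_nonneg t)).comp
    tendsto_natCast_atTop_atTop).congr fun k => ?_
  simp [floorDiv]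

/-- The predictable version of a process, obtained from its values at rational times. -/
noncomputable def leftVersion (x : ℝ≥0 → Ω → ℝ) (t : ℝ≥0) (ω : Ω) : ℝ :=
  limsup (fun k => x (floorDiv k t) ω) atTop

theorem leftVersion_eq {x : ℝ≥0 → Ω → ℝ} {t : ℝ≥0} {ω : Ω}
    (h : ContinuousOn (fun s => x s ω) (Iic t)) : leftVersion x t ω = x t ω :=
  ((h t self_mem_Iic).tendsto.comp (tendsto_floorDiv t)).limsup_eq

/-- The limsup involves only countably many times, all at most `t`, so adaptedness suffices without
any regularity of paths. -/
theorem isStronglyProgressive_leftVersion {x : ℝ≥0 → Ω → ℝ} (hx : Adapted ℱ x) :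
    IsStronglyProgressive ℱ (leftVersion x) := by
  refine IsProgressive.isStronglyProgressive fun i => ?_
  let _ : MeasurableSpace Ω := ℱ i
  refine Measurable.limsup fun k => ?_
  have h1 : Measurable fun q : ℕ × Ω =>
      if (q.1 : ℝ≥0) / k ≤ i then x ((q.1 : ℝ≥0) / k) q.2 else 0 := by
    refine measurable_from_prod_countable_right fun n => ?_
    by_cases h : (n : ℝ≥0) / k ≤ i
    · simpa only [h, if_true] using (hx _).mono (ℱ.mono h) le_rfl
    · simp only [h, if_false]
      exact measurable_const
  have h2 : Measurable fun p : Iic i × Ω => (⌊((p.1 : ℝ≥0) : ℝ) * k⌋₊, p.2) :=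
    (Nat.measurable_floor.comp
      ((measurable_coe_nnreal_real.comp (measurable_subtype_coe.comp measurable_fst)).mul_const _)).prodMk
      measurable_snd
  convert! h1.comp h2 using 1
  ext p
  have : floorDiv k p.1 ≤ i := (floorDiv_le k p.1).trans p.1.2
  exact (if_pos this).symm

/-- Right-closedness makes the infimum of the times with `ω ∈ A t` attained, so the event `ρ ≤ t` is
`A t` itself and lies in `ℱ t`. -/
theorem exists_stoppingTime_of_rightClosed {A : ℝ≥0 → Set Ω} (hA : ∀ t, MeasurableSet[ℱ t] (A t))
    (hmono : Monotone A) (hright : ∀ t ω, ω ∉ A t → ∃ s, t < s ∧ ω ∉ A s) :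
    ∃ ρ : Ω → WithTop ℝ≥0, IsStoppingTime ℱ ρ ∧ ∀ (t : ℝ≥0) (ω : Ω), ρ ω ≤ t ↔ ω ∈ A t := by
  classical
  let ρ : Ω → WithTop ℝ≥0 := fun ω =>
    if ∃ t, ω ∈ A t then ((sInf {t | ω ∈ A t} : ℝ≥0) : WithTop ℝ≥0) else ⊤
  have hρ : ∀ (t : ℝ≥0) (ω : Ω), ρ ω ≤ t ↔ ω ∈ A t := by
    intro t ω
    by_cases h : ∃ t, ω ∈ A t
    · simp only [ρ, if_pos h, WithTop.coe_le_coe]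
      refine ⟨fun ht => ?_, fun ht => csInf_le' ht⟩
      by_contra hn
      obtain ⟨s, hts, hs⟩ := hright t ω hn
      refine hts.not_ge (le_trans (le_csInf h fun r hr => ?_) ht)
      by_contra hsr
      exact hs (hmono (not_le.1 hsr).le hr)
    · simp only [ρ, if_neg h, top_le_iff, WithTop.coe_ne_top, false_iff]
      exact fun ht => h ⟨t, ht⟩
  refine ⟨ρ, fun t => ?_, hρ⟩
  convert! hA t using 1
  ext ω
  exact hρ t ω

/-- The first time at which a process, continuous as long as `E` holds, reaches the level `ε`. -/
theorem exists_hitting (hA : AssumptionA ℱ S) {E : Set (ℝ≥0 × Ω)}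
    (hE : InitiallyEnforceable ℱ S E) {y : ℝ≥0 → Ω → ℝ} (hy : Adapted ℱ y)
    (hc : ∀ t ω, (t, ω) ∈ E → ContinuousOn (fun s => y s ω) (Iic t)) {ε : ℝ}
    (h0 : ∀ ω, (0, ω) ∈ E → y 0 ω ≤ ε) :
    ∃ ρ : Ω → WithTop ℝ≥0, IsStoppingTime ℱ ρ ∧
      (∀ t ω, (t, ω) ∈ E → ∀ s ≤ t, (s : WithTop ℝ≥0) ≤ ρ ω → y s ω ≤ ε) ∧
      ∀ t ω, (t, ω) ∈ E → (∀ s ≤ t, y s ω < ε) → (t : WithTop ℝ≥0) < ρ ω := by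
  -- At rational times up to `t` at which `E` holds, `y` exceeds every level below `ε`. Where `E`
  -- holds at `t`, continuity and compactness turn this into reaching `ε` by time `t`.
  let A : ℝ≥0 → Set Ω := fun t => ⋂ k : ℕ, ⋃ a : ℕ, ⋃ b : ℕ, ⋃ _ : (a : ℝ≥0) / b ≤ t,
    {ω | ((a : ℝ≥0) / b, ω) ∈ E} ∩ {ω | ε - 1 / ((k : ℝ) + 1) < y ((a : ℝ≥0) / b) ω}
  have hmem : ∀ t ω, ω ∈ A t ↔ ∀ k : ℕ, ∃ a b : ℕ, (a : ℝ≥0) / b ≤ t ∧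
      ((a : ℝ≥0) / b, ω) ∈ E ∧ ε - 1 / ((k : ℝ) + 1) < y ((a : ℝ≥0) / b) ω := by
    intro t ω
    simp only [A, mem_iInter, mem_iUnion, mem_inter_iff, mem_ofPred_eq, exists_prop]
  have hlim : ∀ t ω, (t, ω) ∈ E → Tendsto (fun k => y (floorDiv k t) ω) atTop (𝓝 (y t ω)) :=
    fun t ω h => ((hc t ω h) t self_mem_Iic).tendsto.comp (tendsto_floorDiv t)
  have hin : ∀ t ω k, (t, ω) ∈ E → (floorDiv k t, ω) ∈ E := fun t ω k h =>
    hE.initial (floorDiv_le k t) h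
  obtain ⟨ρ, hρ, hρA⟩ : ∃ ρ : Ω → WithTop ℝ≥0, IsStoppingTime ℱ ρ ∧
      ∀ (t : ℝ≥0) (ω : Ω), ρ ω ≤ t ↔ ω ∈ A t := by
    refine exists_stoppingTime_of_rightClosed (fun t => ?_) (fun s t hst ω hω => ?_) ?_
    · refine MeasurableSet.iInter fun k => MeasurableSet.iUnion fun a => MeasurableSet.iUnion
        fun b => MeasurableSet.iUnion fun hab => ℱ.mono hab _ ?_
      exact (hE.measurableSet hA _).inter (hy _ measurableSet_Ioi)
    · rw [hmem] at hω ⊢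
      intro k
      obtain ⟨a, b, h, h'⟩ := hω k
      exact ⟨a, b, h.trans hst, h'⟩
    · intro t ω hω
      rw [hmem] at hω
      push Not at hω
      obtain ⟨k, hk⟩ := hω
      -- If `E` lasts beyond `t`, continuity keeps `y` below `ε - 1 / (k + 2)` for a short while;
      -- otherwise no later time can contribute to `A`.
      by_cases hE' : ∃ t', t < t' ∧ (t', ω) ∈ E
      · obtain ⟨t', htt', ht'⟩ := hE'
        have htE := hE.initial htt'.le ht'
        have hyt : y t ω ≤ ε - 1 / ((k : ℝ) + 1) :=
          le_of_tendsto (hlim t ω htE) (Eventually.of_forall fun j =>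
            hk _ _ (floorDiv_le j t) (hin t ω j htE))
        have hlt : ε - 1 / ((k : ℝ) + 1) < ε - 1 / (((k + 1 : ℕ) : ℝ) + 1) := by
          refine sub_lt_sub_left (one_div_lt_one_div_of_lt (by positivity) ?_) _
          push_cast
          linarith
        have hca : ContinuousAt (fun s => y s ω) t := (hc t' ω ht').continuousAt (Iic_mem_nhds htt')
        have hev := hca.eventually (gt_mem_nhds (hyt.trans_lt hlt))
        obtain ⟨u, hu, hu'⟩ := exists_Ico_subset_of_mem_nhds hev ⟨t', htt'⟩
        obtain ⟨s, hts, hsu⟩ := exists_between hu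
        refine ⟨s, hts, fun hs => ?_⟩
        obtain ⟨a, b, h1, h2, h3⟩ := (hmem s ω).1 hs (k + 1)
        rcases le_or_gt ((a : ℝ≥0) / b) t with h | h
        · exact absurd ((hk a b h h2).trans_lt hlt) h3.not_gt
        · exact absurd (hu' ⟨h.le, h1.trans_lt hsu⟩) h3.not_gt
      · push Not at hE'
        refine ⟨t + 1, lt_add_one t, fun hs => ?_⟩
        obtain ⟨a, b, h1, h2, h3⟩ := (hmem _ ω).1 hs k
        have h : (a : ℝ≥0) / b ≤ t := by
          by_contra h
          exact hE' _ (not_le.1 h) h2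
        exact absurd (hk a b h h2) h3.not_ge
  refine ⟨ρ, hρ, fun t ω ht s hst hs => ?_, fun t ω ht h => ?_⟩
  · have hlt : ∀ s ≤ t, (s : WithTop ℝ≥0) < ρ ω → y s ω ≤ ε := by
      intro s hst hs
      by_contra hys
      have hsE := hE.initial hst ht
      obtain ⟨j, hj⟩ := ((hlim s ω hsE).eventually (lt_mem_nhds (not_le.1 hys))).exists
      refine hs.not_ge ((hρA s ω).2 ((hmem s ω).2 fun k => ?_))
      refine ⟨_, _, floorDiv_le j s, hin s ω j hsE, lt_of_le_of_lt ?_ hj⟩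
      have : (0 : ℝ) ≤ 1 / ((k : ℝ) + 1) := by positivity
      linarith
    -- The bound at `ρ` itself is a left limit, except at time 0, where the hypothesis `h0` is
    -- needed.
    rcases eq_or_ne s 0 with rfl | hs0
    · exact h0 ω (hE.initial hst ht)
    · have : (𝓝[<] s).NeBot := nhdsLT_neBot_of_exists_lt ⟨0, pos_iff_ne_zero.2 hs0⟩
      have hcs : Tendsto (fun r => y r ω) (𝓝[<] s) (𝓝 (y s ω)) :=
        ((hc t ω ht) s hst).mono fun r hr => (le_of_lt hr).trans hst
      refine le_of_tendsto hcs ?_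
      filter_upwards [self_mem_nhdsWithin] with r hr
      exact hlt r ((le_of_lt hr).trans hst) (lt_of_lt_of_le (by exact_mod_cast hr) hs)
  · by_contra hρt
    have hAt := (hmem t ω).1 ((hρA t ω).1 (not_lt.1 hρt))
    have hcomp : IsCompact (Iic t) := by
      rw [← Icc_bot]
      exact isCompact_Icc
    obtain ⟨s, hst, hs⟩ := hcomp.exists_isMaxOn ⟨t, self_mem_Iic⟩ (hc t ω ht)
    obtain ⟨k, hk⟩ := exists_nat_one_div_lt (sub_pos.2 (h s hst))
    obtain ⟨a, b, h1, -, h3⟩ := hAt k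
    have := hs (show (a : ℝ≥0) / b ∈ Iic t from h1)
    simp only [mem_ofPred_eq] at this
    linarith

/-! ### Tradable processes and versions of martingales -/

theorem liminf_add_one_div {z : EReal} (hz : 0 ≤ z) :
    liminf (fun k : ℕ => z + ((1 / ((k : ℝ) + 1) : ℝ) : EReal)) atTop = z := by
  have h0 : Tendsto (fun k : ℕ => ((1 / ((k : ℝ) + 1) : ℝ) : EReal)) atTop (𝓝 0) := by
    rw [← EReal.coe_zero]
    exact (continuous_coe_real_ereal.tendsto _).comp tendsto_one_div_add_atTop_nhds_zero_nat
  have hz' : z ≠ ⊥ := fun h => absurd (h ▸ hz) (by simp)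
  have hadd := (EReal.continuousAt_add (p := (z, 0)) (Or.inr (by simp)) (Or.inl hz')).tendsto.comp
    (tendsto_const_nhds.prodMk_nhds h0)
  simp only [add_zero] at hadd
  exact hadd.liminf_eq

theorem abs_coe_sub_lt {a : ℝ} {b : EReal} {ε : ℝ}
    (h : ((a : EReal) - b).abs < ENNReal.ofReal ε) : b = (b.toReal : EReal) ∧ |a - b.toReal| < ε := by
  induction b with
  | bot => simp at h
  | top => simp at h
  | coe b =>
    rw [← EReal.coe_sub, EReal.abs_def, ENNReal.ofReal_lt_ofReal_iff_of_nonneg (abs_nonneg _)] at h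
    exact ⟨by simp, by simpa using h⟩

/-- A nonnegative capital remains superhedged after trading in `x` between two stopping times. -/
def Tradable (ℱ : Filtration ℝ≥0 m) (S : Fin d → ℝ≥0 → Ω → ℝ) (x : ℝ≥0 → Ω → ℝ) : Prop :=
  ∀ Z, NonnegSupermartingale ℱ S Z → ∀ (τ τ' : Ω → WithTop ℝ≥0) (hτ : IsStoppingTime ℱ τ),
    IsStoppingTime ℱ τ' → (∀ ω, τ ω ≤ τ' ω) → ∀ g : Ω → ℝ, Measurable[hτ.measurableSpace] g →
    ∀ K : ℝ, (∀ ω, |g ω| ≤ K) → ∀ E, InitiallyEnforceable ℱ S E →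
    (∀ t ω, (t, ω) ∈ E →
      0 ≤ Z t ω + ((g ω * (x (cap t (τ' ω)) ω - x (cap t (τ ω)) ω) : ℝ) : EReal)) →
    ∃ Z' F, NonnegSupermartingale ℱ S Z' ∧ InitiallyEnforceable ℱ S F ∧
      (∀ ω, Z' 0 ω = Z 0 ω) ∧ ∀ t ω, (t, ω) ∈ F →
        Z t ω + ((g ω * (x (cap t (τ' ω)) ω - x (cap t (τ ω)) ω) : ℝ) : EReal) ≤ Z' t ω

/-- The sum of `Z` and the gain is known to be nonnegative only on `E`. Adding `V / (k + 1)`,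
infinite off `E`, repairs this everywhere, and the extra cost `1 / (k + 1)` disappears in the
liminf. -/
theorem IsSimpleCapital.tradable (j₀ : Fin d) {Y : ℝ≥0 → Ω → ℝ} (hY : IsSimpleCapital ℱ S Y) :
    Tradable ℱ S Y := by
  intro Z hZ τ τ' hτ hτ' hle g hg K hK E hE hpos
  obtain ⟨V, hV, hV0, hVE⟩ := hE.enforceable
  have hW := hY.transform j₀ 0 hτ hτ' hle hg hK
  simp only [zero_add] at hW
  have ha : ∀ k : ℕ, (0 : ℝ) < 1 / ((k : ℝ) + 1) := fun k => by positivity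
  have hVk := fun k => hV.const_mul j₀ (ha k).le
  have hC : ∀ k : ℕ, NonnegSupermartingale ℱ S fun t ω =>
      Z t ω + ((1 / ((k : ℝ) + 1) : ℝ) : EReal) * V t ω +
        ((g ω * (Y (cap t (τ' ω)) ω - Y (cap t (τ ω)) ω) : ℝ) : EReal) := by
    refine fun k => (hZ.add' (hVk k)).add _ _ hW fun t ω => ?_
    by_cases h : (t, ω) ∈ E
    · rw [add_right_comm]
      exact add_nonneg (hpos t ω h) ((hVk k).nonneg t ω)
    · have hz : Z t ω ≠ ⊥ := fun h => absurd (h ▸ hZ.nonneg t ω) (by simp)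
      rw [hVE t ω h, EReal.coe_mul_top_of_pos (ha k), EReal.add_top_of_ne_bot hz,
        EReal.top_add_coe]
      exact le_top
  refine ⟨_, univ, .liminf _ hC, .univ ℱ S j₀, fun ω => ?_, fun t ω _ => ?_⟩
  · simp only [hV0, zero_cap, sub_self, mul_zero, mul_one, EReal.coe_zero, add_zero]
    exact liminf_add_one_div (hZ.nonneg 0 ω)
  · refine le_liminf_of_le (by isBoundedDefault) (Eventually.of_forall fun k => ?_)
    gcongr
    exact le_add_of_nonneg_right ((hVk k).nonneg t ω)

theorem supDist_mono (Y Z : ℝ≥0 → Ω → EReal) (p : ℝ≥0 → Prop) (ω : Ω) {s t : ℝ≥0} (h : s ≤ t) :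
    supDist Y Z p s ω ≤ supDist Y Z p t ω :=
  iSup_mono fun _ => iSup_mono' fun hr => ⟨hr.trans h, le_rfl⟩

theorem TendstoLocUnifWIE.initiallyEnforceable {Y : ℕ → ℝ≥0 → Ω → EReal} {Z : ℝ≥0 → Ω → EReal}
    (h : TendstoLocUnifWIE ℱ S Y Z) : InitiallyEnforceable ℱ S
      {q | Tendsto (fun n => supDist (Y n) Z (fun _ => True) q.1 q.2) atTop (𝓝 0)} :=
  ⟨h, fun _ _ ω hst ht => tendsto_of_tendsto_of_tendsto_of_le_of_le tendsto_const_nhds ht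
    (fun _ => bot_le) fun n => supDist_mono (Y n) Z _ ω hst⟩

theorem eventually_abs_sub_lt {Y : ℕ → ℝ≥0 → Ω → EReal} {y : ℕ → ℝ≥0 → Ω → ℝ}
    {Z : ℝ≥0 → Ω → EReal} {t : ℝ≥0} {ω : Ω} (hY : ∀ n, ∀ s ≤ t, Y n s ω = y n s ω)
    (h : Tendsto (fun n => supDist (Y n) Z (fun _ => True) t ω) atTop (𝓝 0)) {ε : ℝ} (hε : 0 < ε) :
    ∀ᶠ n in atTop, ∀ s ≤ t, Z s ω = ((Z s ω).toReal : EReal) ∧ |y n s ω - (Z s ω).toReal| < ε := by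
  filter_upwards [h.eventually (gt_mem_nhds (ENNReal.ofReal_pos.2 hε))] with n hn s hs
  refine abs_coe_sub_lt (lt_of_le_of_lt ?_ hn)
  rw [← hY n s hs]
  exact le_iSup₂_of_le s hs (le_iSup_of_le trivial le_rfl)

/-- Uniform limits of tradable processes are tradable. -/
theorem Tradable.of_tendsto (hA : AssumptionA ℱ S) (j₀ : Fin d) {x : ℝ≥0 → Ω → ℝ}
    {xn : ℕ → ℝ≥0 → Ω → ℝ} {G : Set (ℝ≥0 × Ω)} (hG : InitiallyEnforceable ℱ S G)
    (hxn : ∀ n, Tradable ℱ S (xn n)) (hxnA : ∀ n, Adapted ℱ (xn n)) (hxA : Adapted ℱ x)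
    (hxnc : ∀ n t ω, (t, ω) ∈ G → ContinuousOn (fun s => xn n s ω) (Iic t))
    (hxc : ∀ t ω, (t, ω) ∈ G → ContinuousOn (fun s => x s ω) (Iic t))
    (hlim : ∀ t ω, (t, ω) ∈ G → ∀ ε > 0, ∀ᶠ n in atTop, ∀ s ≤ t, |xn n s ω - x s ω| < ε) :
    Tradable ℱ S x := by
  intro Z hZ τ τ' hτ hτ' hle g hg K hK E hE hpos
  have step : ∀ η : ℝ, 0 < η → ∃ Z' F, NonnegSupermartingale ℱ S Z' ∧
      InitiallyEnforceable ℱ S F ∧ (∀ ω, Z' 0 ω = Z 0 ω + (η : EReal)) ∧ ∀ t ω, (t, ω) ∈ F →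
        Z t ω + ((g ω * (x (cap t (τ' ω)) ω - x (cap t (τ ω)) ω) : ℝ) : EReal) ≤ Z' t ω := by
    intro η hη
    have hK' : 0 < |K| + 1 := by positivity
    -- Replacing `x` by `xn n` with error at most `ε` at both trading times costs at most `|g| * (2
    -- * ε)`, which `η` covers.
    obtain ⟨ε, hε, hεη⟩ : ∃ ε : ℝ, 0 < ε ∧ (|K| + 1) * (2 * ε) = η :=
      ⟨η / (2 * (|K| + 1)), by positivity, by field_simp⟩
    -- Only increments matter, so the error is normalised to vanish at time 0 and starts below `ε`.
    let y : ℕ → ℝ≥0 → Ω → ℝ := fun n s ω => |xn n s ω - x s ω - (xn n 0 ω - x 0 ω)|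
    have hyA : ∀ n, Adapted ℱ (y n) := by
      intro n t
      have h0 : ∀ z : ℝ≥0 → Ω → ℝ, Adapted ℱ z → Measurable[ℱ t] (z 0) := fun z hz =>
        (hz 0).mono (ℱ.mono bot_le) le_rfl
      exact measurable_norm.comp
        (((hxnA n t).sub (hxA t)).sub ((h0 _ (hxnA n)).sub (h0 _ hxA)))
    have hyc : ∀ n t ω, (t, ω) ∈ G → ContinuousOn (fun s => y n s ω) (Iic t) := fun n t ω h =>
      (((hxnc n t ω h).sub (hxc t ω h)).sub continuousOn_const).abs
    choose ρ hρ hρ1 hρ2 using fun n => exists_hitting hA hG (hyA n) (hyc n) (ε := ε)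
      (fun ω _ => by simp [y, hε.le])
    -- Capping both trading times at `ρ n` amounts to stopping the gain there; the indicator is
    -- needed for measurability.
    have hind : ∀ n t ω, {ω | τ ω < ρ n ω}.indicator g ω *
        (xn n (cap t (min (τ' ω) (ρ n ω))) ω - xn n (cap t (min (τ ω) (ρ n ω))) ω) =
        g ω * (xn n (cap (cap t (ρ n ω)) (τ' ω)) ω - xn n (cap (cap t (ρ n ω)) (τ ω)) ω) := by
      intro n t ω
      rw [cap_cap, cap_cap, min_comm (ρ n ω), min_comm (ρ n ω)]
      by_cases h : τ ω < ρ n ω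
      · have h' : ω ∈ {ω | τ ω < ρ n ω} := h
        rw [indicator_of_mem h']
      · rw [min_eq_right (not_lt.1 h), min_eq_right ((not_lt.1 h).trans (hle ω))]
        simp
    have hcomp : ∀ n t ω, (t, ω) ∈ G →
        g ω * (x (cap (cap t (ρ n ω)) (τ' ω)) ω - x (cap (cap t (ρ n ω)) (τ ω)) ω) ≤
        η + g ω * (xn n (cap (cap t (ρ n ω)) (τ' ω)) ω - xn n (cap (cap t (ρ n ω)) (τ ω)) ω) := by
      intro n t ω h
      have hy : ∀ σ : WithTop ℝ≥0, y n (cap (cap t (ρ n ω)) σ) ω ≤ ε := by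
        intro σ
        refine hρ1 n t ω h _ ((cap_le _ _).trans (cap_le _ _)) (le_trans ?_ (coe_cap_le t (ρ n ω)))
        exact_mod_cast cap_le _ _
      have h1 := abs_le.1 (hy (τ' ω))
      have h2 := abs_le.1 (hy (τ ω))
      set a := x (cap (cap t (ρ n ω)) (τ' ω)) ω
      set b := x (cap (cap t (ρ n ω)) (τ ω)) ω
      set a' := xn n (cap (cap t (ρ n ω)) (τ' ω)) ω
      set b' := xn n (cap (cap t (ρ n ω)) (τ ω)) ω
      have h3 : |(a - b) - (a' - b')| ≤ 2 * ε := abs_le.2 ⟨by linarith, by linarith⟩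
      have h4 : g ω * ((a - b) - (a' - b')) ≤ (|K| + 1) * (2 * ε) := by
        refine (le_abs_self _).trans ?_
        rw [abs_mul]
        refine mul_le_mul ((hK ω).trans ((le_abs_self K).trans (by linarith))) h3 (abs_nonneg _)
          hK'.le
      rw [hεη] at h4
      linarith
    have hpre : ∀ n, NonnegSupermartingale ℱ S fun t ω =>
        stoppedProcess Z (ρ n) t ω + (η : EReal) := fun n =>
      (hZ.stopped j₀ (hρ n)).add' (.const ℱ S j₀ hη.le)
    have hdom : ∀ n t ω, (t, ω) ∈ G → Z (cap t (ρ n ω)) ω +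
          ((g ω * (x (cap (cap t (ρ n ω)) (τ' ω)) ω - x (cap (cap t (ρ n ω)) (τ ω)) ω) : ℝ) :
            EReal) ≤ stoppedProcess Z (ρ n) t ω + (η : EReal) +
          (({ω | τ ω < ρ n ω}.indicator g ω * (xn n (cap t (min (τ' ω) (ρ n ω))) ω -
            xn n (cap t (min (τ ω) (ρ n ω))) ω) : ℝ) : EReal) := by
      intro n t ω h
      rw [hind, add_assoc, ← EReal.coe_add, stoppedProcess_apply]
      gcongr
      exact_mod_cast hcomp n t ω h
    choose Z' F hZ' hF hZ'0 hZ'F using fun n => hxn n _ (hpre n) _ _ (hτ.min (hρ n))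
      (hτ'.min (hρ n)) (fun ω => min_le_min_right _ (hle ω)) ({ω | τ ω < ρ n ω}.indicator g)
      (measurable_indicator_stopping_lt hτ (hρ n) hg) |K|
      (fun ω => by
        by_cases h : ω ∈ {ω | τ ω < ρ n ω}
        · rw [indicator_of_mem h]
          exact (hK ω).trans (le_abs_self K)
        · rw [indicator_of_notMem h, abs_zero]
          exact abs_nonneg _) _ (hG.inter j₀ hE)
      (fun t ω h => (hpos _ ω (hE.initial (cap_le t (ρ n ω)) h.2)).trans (hdom n t ω h.1))
    refine ⟨_, (⋂ n, F n) ∩ G, .liminf _ hZ', (InitiallyEnforceable.iInter j₀ hF).inter j₀ hG,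
      fun ω => ?_, fun t ω h => ?_⟩
    · simp only [hZ'0, stoppedProcess_apply, zero_cap, liminf_const]
    · refine le_liminf_of_le (by isBoundedDefault) ?_
      -- The normalised error is a difference of two errors below `ε / 2`, so eventually `ρ n` lies
      -- beyond `t` and stopping has no effect.
      filter_upwards [hlim t ω h.2 (ε / 2) (by positivity)] with n hn
      have htρ : (t : WithTop ℝ≥0) < ρ n ω := by
        refine hρ2 n t ω h.2 fun s hs => ?_
        refine lt_of_le_of_lt (abs_sub _ _) ?_
        have h1 := hn s hs
        have h2 := hn 0 bot_le
        linarith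
      have := (hdom n t ω h.2).trans (hZ'F n t ω (mem_iInter.1 h.1 n))
      rwa [cap_of_le htρ.le] at this
  choose Z' F hZ' hF hZ'0 hZ'F using fun k : ℕ => step (1 / ((k : ℝ) + 1)) (by positivity)
  refine ⟨_, ⋂ k, F k, .liminf _ hZ', .iInter j₀ hF, fun ω => ?_, fun t ω h => ?_⟩
  · simp only [hZ'0]
    exact liminf_add_one_div (hZ.nonneg 0 ω)
  · exact le_liminf_of_le (by isBoundedDefault) (Eventually.of_forall fun k =>
      hZ'F k t ω (mem_iInter.1 h k))

/-- Every martingale agrees with instant enforcement with a continuous, progressive and tradable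
process. -/
theorem IsMartingale.exists_version (hS : ∀ j, Adapted ℱ (S j))
    (hc : ∀ j ω, Continuous fun t => S j t ω) (hA : AssumptionA ℱ S) (j₀ : Fin d)
    {X : ℝ≥0 → Ω → EReal} (hX : IsMartingale ℱ S X) :
    ∃ (x : ℝ≥0 → Ω → ℝ) (E : Set (ℝ≥0 × Ω)), InitiallyEnforceable ℱ S E ∧
      IsStronglyProgressive ℱ x ∧
      (∀ t ω, (t, ω) ∈ E → X t ω = x t ω ∧ ContinuousOn (fun s => x s ω) (Iic t)) ∧
      Tradable ℱ S x := by
  induction hX with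
  | capital Y hY =>
    exact ⟨Y, univ, .univ ℱ S j₀,
      isStronglyProgressive_of_continuous (hY.adapted hS hc) (hY.continuous hc),
      fun t ω _ => ⟨rfl, (hY.continuous hc ω).continuousOn⟩, hY.tradable j₀⟩
  | lim X Xn _ hX _ hlim ih =>
    choose xn En hEn hxn hXn htr using ih
    let x₀ : ℝ≥0 → Ω → ℝ := fun t ω => (X t ω).toReal
    have hx₀ : Adapted ℱ x₀ := fun t => measurable_ereal_toReal.comp (hX t)
    let G := (⋂ n, En n) ∩
      {q | Tendsto (fun n => supDist (Xn n) X (fun _ => True) q.1 q.2) atTop (𝓝 0)}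
    have hG : InitiallyEnforceable ℱ S G :=
      (InitiallyEnforceable.iInter j₀ hEn).inter j₀ hlim.initiallyEnforceable
    have hev : ∀ t ω, (t, ω) ∈ G → ∀ ε > 0, ∀ᶠ n in atTop, ∀ s ≤ t,
        X s ω = (x₀ s ω : EReal) ∧ |xn n s ω - x₀ s ω| < ε := by
      intro t ω h ε hε
      refine eventually_abs_sub_lt (fun n s hs => ?_) h.2 hε
      exact (hXn n s ω ((hEn n).initial hs (mem_iInter.1 h.1 n))).1
    have hxnc : ∀ n t ω, (t, ω) ∈ G → ContinuousOn (fun s => xn n s ω) (Iic t) := fun n t ω h =>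
      (hXn n t ω (mem_iInter.1 h.1 n)).2
    have hcx : ∀ t ω, (t, ω) ∈ G → ContinuousOn (fun s => x₀ s ω) (Iic t) := by
      intro t ω h
      refine TendstoUniformlyOn.continuousOn (F := fun n s => xn n s ω) (p := atTop) ?_
        (Frequently.of_forall fun n => hxnc n t ω h)
      refine Metric.tendstoUniformlyOn_iff.2 fun ε hε => ?_
      filter_upwards [hev t ω h ε hε] with n hn s hs
      rw [dist_comm]
      exact (hn s hs).2
    have heq : ∀ t ω, (t, ω) ∈ G → leftVersion x₀ t ω = x₀ t ω := fun t ω h =>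
      leftVersion_eq (hcx t ω h)
    have hcl : ∀ t ω, (t, ω) ∈ G → ContinuousOn (fun s => leftVersion x₀ s ω) (Iic t) :=
      fun t ω h => (hcx t ω h).congr fun s hs => heq s ω (hG.initial hs h)
    have hp := isStronglyProgressive_leftVersion hx₀
    -- Off `G` the paths of `x₀` may be irregular, hence the passage to `leftVersion`, which agrees
    -- with `x₀` on `G`.
    refine ⟨leftVersion x₀, G, hG, hp, fun t ω h => ⟨?_, hcl t ω h⟩,
      Tradable.of_tendsto hA j₀ hG htr (fun n => (hxn n).stronglyAdapted.adapted)
        hp.stronglyAdapted.adapted hxnc hcl fun t ω h ε hε => ?_⟩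
    · obtain ⟨n, hn⟩ := (hev t ω h 1 one_pos).exists
      rw [heq t ω h]
      exact (hn t le_rfl).1
    · filter_upwards [hev t ω h ε hε] with n hn s hs
      rw [heq s ω (hG.initial hs h)]
      exact (hn s hs).2

/-! ### Construction of fine covers -/

/-- On `E`, the oscillation of `x` around its value at `τ n` is at most `δ` up to `τ (n + 1)`, and
only finitely many times `τ n` have passed. -/
structure IsCoverOn (ℱ : Filtration ℝ≥0 m) (E : Set (ℝ≥0 × Ω)) (x : ℝ≥0 → Ω → ℝ) (δ : ℝ)
    (τ : ℕ → Ω → WithTop ℝ≥0) : Prop extends IsStoppingSequence ℱ τ where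
  finite : ∀ t ω, (t, ω) ∈ E → {n | τ n ω ≤ (t : WithTop ℝ≥0)}.Finite
  osc : ∀ t ω, (t, ω) ∈ E → ∀ n s, cap t (τ n ω) ≤ s → s ≤ cap t (τ (n + 1) ω) →
    |x s ω - x (cap t (τ n ω)) ω| ≤ δ

theorem exists_next_time (hA : AssumptionA ℱ S) {E : Set (ℝ≥0 × Ω)}
    (hE : InitiallyEnforceable ℱ S E) {x : ℝ≥0 → Ω → ℝ} (hx : IsStronglyProgressive ℱ x)
    (hc : ∀ t ω, (t, ω) ∈ E → ContinuousOn (fun s => x s ω) (Iic t)) {δ : ℝ} (hδ : 0 < δ)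
    {σ : Ω → WithTop ℝ≥0} (hσ : IsStoppingTime ℱ σ) :
    ∃ ρ : Ω → WithTop ℝ≥0, IsStoppingTime ℱ ρ ∧ (∀ ω, σ ω ≤ ρ ω) ∧
      (∀ t ω, (t, ω) ∈ E → ∀ s ≤ t, (s : WithTop ℝ≥0) ≤ ρ ω → |x s ω - x (cap s (σ ω)) ω| ≤ δ) ∧
      ∀ t ω, (t, ω) ∈ E → (∀ s ≤ t, |x s ω - x (cap s (σ ω)) ω| < δ) →
        (t : WithTop ℝ≥0) < ρ ω := by
  obtain ⟨ρ, hρ, h1, h2⟩ := exists_hitting hA hE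
    (y := fun s ω => |x s ω - x (cap s (σ ω)) ω|) (ε := δ)
    (fun t => measurable_norm.comp ((hx.stronglyAdapted.adapted t).sub
      (hx.stronglyAdapted_stoppedProcess hσ t).measurable))
    (fun t ω h => ((hc t ω h).sub ((hc t ω h).comp (continuous_cap _).continuousOn
      fun s hs => (cap_le s _).trans hs)).abs)
    (fun ω _ => by simp [zero_cap, hδ.le])
  -- The properties of `ρ` concern only `E`; the maximum secures `σ ω ≤ ρ ω` for every `ω`.
  refine ⟨fun ω => max (ρ ω) (σ ω), hρ.max hσ, fun ω => le_max_right _ _,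
    fun t ω h s hs hsρ => ?_, fun t ω h h' => lt_max_of_lt_left (h2 t ω h h')⟩
  rcases le_max_iff.1 hsρ with hsρ | hsσ
  · exact h1 t ω h s hs hsρ
  · simp [cap_of_le hsσ, hδ.le]

/-- Iterate `exists_next_time`. Infinitely many times before `t` would accumulate at some `l ≤ t`
while the path moves by at least `δ` between consecutive ones, contradicting continuity at `l`. -/
theorem exists_cover (hA : AssumptionA ℱ S) {E : Set (ℝ≥0 × Ω)}
    (hE : InitiallyEnforceable ℱ S E) {x : ℝ≥0 → Ω → ℝ} (hx : IsStronglyProgressive ℱ x)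
    (hc : ∀ t ω, (t, ω) ∈ E → ContinuousOn (fun s => x s ω) (Iic t)) {δ : ℝ} (hδ : 0 < δ) :
    ∃ τ, IsCoverOn ℱ E x δ τ := by
  choose next hnext hle h1 h2 using fun (σ : Ω → WithTop ℝ≥0) (hσ : IsStoppingTime ℱ σ) =>
    exists_next_time hA hE hx hc hδ hσ
  let T : ℕ → {σ : Ω → WithTop ℝ≥0 // IsStoppingTime ℱ σ} := fun n =>
    Nat.rec ⟨fun _ => ((0 : ℝ≥0) : WithTop ℝ≥0), isStoppingTime_const ℱ 0⟩
      (fun _ σ => ⟨next σ.1 σ.2, hnext σ.1 σ.2⟩) n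
  have hmono : ∀ ω, Monotone fun n => (T n).1 ω := fun ω =>
    monotone_nat_of_le_succ fun n => hle _ (T n).2 ω
  refine ⟨fun n => (T n).1, ⟨⟨fun n => (T n).2, fun n ω => hle _ (T n).2 ω, fun ω => rfl⟩,
    fun t ω ht => ?_, fun t ω ht n s hs hs' => ?_⟩⟩
  · by_contra hinf
    have hall : ∀ n, (T n).1 ω ≤ t := by
      intro n
      obtain ⟨k, hk, hnk⟩ := Set.Infinite.exists_gt hinf n
      exact (hmono ω hnk.le).trans hk
    let a : ℕ → ℝ≥0 := fun n => cap t ((T n).1 ω)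
    have ha : ∀ n, (a n : WithTop ℝ≥0) = (T n).1 ω := fun n => coe_cap_of_ge (hall n)
    have ham : Monotone a := fun i j hij => cap_mono_right t (hmono ω hij)
    have hat : ∀ n, a n ≤ t := fun n => cap_le _ _
    have hlim := tendsto_atTop_ciSup ham ⟨t, by rintro _ ⟨n, rfl⟩; exact hat n⟩
    set l := ⨆ n, a n
    have hlt : l ≤ t := ciSup_le' hat
    have hs : ∀ n, ∃ s, a n ≤ s ∧ s ≤ a (n + 1) ∧ δ ≤ |x s ω - x (a n) ω| := by
      intro n
      have hn : (T (n + 1)).1 ω = next (T n).1 (T n).2 ω := rfl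
      by_contra hcon
      push Not at hcon
      refine (ha (n + 1)).not_lt ?_
      rw [hn]
      refine h2 _ (T n).2 _ ω (hE.initial (hat (n + 1)) ht) fun s hs => ?_
      rcases le_total (a n) s with h | h
      · have : cap s ((T n).1 ω) = a n := by
          have : (cap s ((T n).1 ω) : WithTop ℝ≥0) = a n := by
            rw [ha]
            exact coe_cap_of_ge (by rw [← ha]; exact_mod_cast h)
          exact_mod_cast this
        rw [this]
        exact hcon s h hs
      · have : cap s ((T n).1 ω) = s := cap_of_le (by rw [← ha]; exact_mod_cast h)
        rw [this]
        simpa using hδ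
    choose s hs1 hs2 hs3 using hs
    have hsl : Tendsto s atTop (𝓝 l) := tendsto_of_tendsto_of_tendsto_of_le_of_le hlim
      (hlim.comp (tendsto_add_atTop_nat 1)) hs1 hs2
    have hx' : ∀ u : ℕ → ℝ≥0, (∀ n, u n ≤ t) → Tendsto u atTop (𝓝 l) →
        Tendsto (fun n => x (u n) ω) atTop (𝓝 (x l ω)) := fun u hu hul =>
      (hc t ω ht l hlt).tendsto.comp
        (tendsto_nhdsWithin_iff.2 ⟨hul, Eventually.of_forall hu⟩)
    have hd := ((hx' s (fun n => (hs2 n).trans (hat (n + 1))) hsl).sub (hx' a hat hlim)).abs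
    rw [sub_self, abs_zero] at hd
    exact hδ.not_ge (ge_of_tendsto hd (Eventually.of_forall hs3))
  · have hst : s ≤ t := hs'.trans (cap_le _ _)
    have he : cap s ((T n).1 ω) = cap t ((T n).1 ω) := by
      refine le_antisymm (cap_mono_left hst _) ?_
      have : (cap t ((T n).1 ω) : WithTop ℝ≥0) ≤ cap s ((T n).1 ω) := by
        rw [coe_cap s]
        exact le_min (by exact_mod_cast hs) (coe_cap_le _ _)
      exact_mod_cast this
    have := h1 _ (T n).2 t ω ht s hst
      (le_trans (by exact_mod_cast hs') (coe_cap_le t ((T (n + 1)).1 ω)))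
    rwa [he] at this

/-- Deviations of at most `δ` from the left endpoint value give a total oscillation of at most `2 *
δ`. -/
theorem IsCoverOn.isFineCoverWIE {E : Set (ℝ≥0 × Ω)} (hE : InitiallyEnforceable ℱ S E)
    {X : ℝ≥0 → Ω → EReal} {x : ℝ≥0 → Ω → ℝ} (hXx : ∀ t ω, (t, ω) ∈ E → X t ω = x t ω)
    {δ : ℝ} {τ : ℕ → Ω → WithTop ℝ≥0} (hτ : IsCoverOn ℱ E x δ τ) :
    IsFineCoverWIE ℱ S X (2 * δ) τ := by
  refine ⟨hτ.toIsStoppingSequence, E, hE.enforceable, fun ⟨t, ω⟩ h =>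
    ⟨fun s hs => ?_, hτ.finite t ω h, fun n => ?_⟩⟩
  · dsimp only
    rw [hXx s ω (hE.initial hs h)]
    exact ⟨EReal.coe_ne_top _, EReal.coe_ne_bot _⟩
  · have hosc : ∀ s : ℝ≥0, min (τ n ω) (t : WithTop ℝ≥0) ≤ s ∧
        (s : WithTop ℝ≥0) ≤ min (τ (n + 1) ω) t →
        X s ω = x s ω ∧ |x s ω - x (cap t (τ n ω)) ω| ≤ δ := by
      rintro s ⟨h1, h2⟩
      rw [min_comm, ← coe_cap] at h1 h2
      have h1 : cap t (τ n ω) ≤ s := by exact_mod_cast h1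
      have h2 : s ≤ cap t (τ (n + 1) ω) := by exact_mod_cast h2
      exact ⟨hXx s ω (hE.initial (h2.trans (cap_le _ _)) h), hτ.osc t ω h n s h1 h2⟩
    have hsup : (⨆ (s : ℝ≥0) (_ : min (τ n ω) (t : WithTop ℝ≥0) ≤ s ∧
        (s : WithTop ℝ≥0) ≤ min (τ (n + 1) ω) t), X s ω) ≤
        ((x (cap t (τ n ω)) ω + δ : ℝ) : EReal) := by
      refine iSup₂_le fun s hs => ?_
      rw [(hosc s hs).1]
      exact_mod_cast (by linarith [(abs_le.1 (hosc s hs).2).2] : x s ω ≤ x (cap t (τ n ω)) ω + δ)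
    have hinf : ((x (cap t (τ n ω)) ω - δ : ℝ) : EReal) ≤
        (⨅ (s : ℝ≥0) (_ : min (τ n ω) (t : WithTop ℝ≥0) ≤ s ∧
          (s : WithTop ℝ≥0) ≤ min (τ (n + 1) ω) t), X s ω) := by
      refine le_iInf₂ fun s hs => ?_
      rw [(hosc s hs).1]
      exact_mod_cast (by linarith [(abs_le.1 (hosc s hs).2).1] : x (cap t (τ n ω)) ω - δ ≤ x s ω)
    refine (EReal.sub_le_sub hsup hinf).trans (le_of_eq ?_)
    rw [← EReal.coe_sub]
    congr 1
    ring

/-! ### Squared increments and the hedge of the square -/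

/-- The sum of the first `N` squared increments of `x` along `τ`. -/
noncomputable def partialQV (x : ℝ≥0 → Ω → ℝ) (τ : ℕ → Ω → WithTop ℝ≥0) (N : ℕ) (t : ℝ≥0) (ω : Ω) : ℝ :=
  ∑ n ∈ Finset.range N, (x (cap t (τ (n + 1) ω)) ω - x (cap t (τ n ω)) ω) ^ 2

theorem partialQV_mono (x : ℝ≥0 → Ω → ℝ) (τ : ℕ → Ω → WithTop ℝ≥0) {M N : ℕ} (h : M ≤ N)
    (t : ℝ≥0) (ω : Ω) : partialQV x τ M t ω ≤ partialQV x τ N t ω :=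
  Finset.sum_le_sum_of_subset_of_nonneg (Finset.range_mono h) fun _ _ _ => sq_nonneg _

/-- The sum is not monotone in time, but increments completed by time `s` are the same at `t`. At
most one is in progress at `s`, and it contributes at most `δ ^ 2`. The equality clause in the
induction ensures that this error is paid once. -/
theorem IsCoverOn.partialQV_le {E : Set (ℝ≥0 × Ω)} (hE : InitiallyEnforceable ℱ S E)
    {x : ℝ≥0 → Ω → ℝ} {δ : ℝ} {τ : ℕ → Ω → WithTop ℝ≥0} (hτ : IsCoverOn ℱ E x δ τ) {s t : ℝ≥0}
    (hst : s ≤ t) {ω : Ω} (ht : (t, ω) ∈ E) (N : ℕ) :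
    partialQV x τ N s ω ≤ partialQV x τ N t ω + δ ^ 2 := by
  suffices (τ N ω ≤ s → partialQV x τ N s ω = partialQV x τ N t ω) ∧
      partialQV x τ N s ω ≤ partialQV x τ N t ω + δ ^ 2 from this.2
  induction N with
  | zero => exact ⟨fun _ => rfl, by simp [partialQV, sq_nonneg]⟩
  | succ N ih =>
    have hmono := hτ.mono N ω
    have hsucc : ∀ r, partialQV x τ (N + 1) r ω = partialQV x τ N r ω +
        (x (cap r (τ (N + 1) ω)) ω - x (cap r (τ N ω)) ω) ^ 2 := fun r =>
      Finset.sum_range_succ _ _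
    rw [hsucc, hsucc]
    refine ⟨fun h => ?_, ?_⟩
    · rw [ih.1 (hmono.trans h), cap_eq_cap_of_le h hst, cap_eq_cap_of_le (hmono.trans h) hst]
    · have hnn := sq_nonneg (x (cap t (τ (N + 1) ω)) ω - x (cap t (τ N ω)) ω)
      rcases le_or_gt (τ N ω) s with h | h
      · have hosc := hτ.osc s ω (hE.initial hst ht) N _ (cap_mono_right s hmono) le_rfl
        have hsq := sq_le_sq' (by linarith [(abs_le.1 hosc).1]) (abs_le.1 hosc).2
        rw [ih.1 h]
        linarith
      · rw [cap_of_le h.le, cap_of_le (h.le.trans hmono), sub_self]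
        have := ih.2
        linarith

/-- Trading towards the square of `x` along `τ`, starting with the capital `ε`, until the quadratic
variation exceeds `ε` or `x` exceeds `K`. -/
theorem exists_square_hedge (hA : AssumptionA ℱ S) (j₀ : Fin d) {E : Set (ℝ≥0 × Ω)}
    (hE : InitiallyEnforceable ℱ S E) {x : ℝ≥0 → Ω → ℝ} (hx : IsStronglyProgressive ℱ x)
    (hc : ∀ t ω, (t, ω) ∈ E → ContinuousOn (fun s => x s ω) (Iic t)) (htr : Tradable ℱ S x)
    (hx0 : ∀ ω, (0, ω) ∈ E → x 0 ω = 0) {τ : ℕ → Ω → WithTop ℝ≥0}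
    (hτ : IsStoppingSequence ℱ τ) {ε K : ℝ} (hε : 0 < ε) (hK : 0 < K) (N : ℕ) :
    ∃ W F, NonnegSupermartingale ℱ S W ∧ InitiallyEnforceable ℱ S F ∧
      (∀ ω, W 0 ω = (ε : EReal)) ∧ ∀ t ω, (t, ω) ∈ F → (t : WithTop ℝ≥0) ≤ τ N ω →
        (∀ s ≤ t, partialQV x τ N s ω < ε) → (∀ s ≤ t, |x s ω| < K) →
        ((x t ω ^ 2 : ℝ) : EReal) ≤ W t ω := by
  have hxA := hx.stronglyAdapted.adapted
  obtain ⟨ρ₁, hρ₁, h₁, h₁'⟩ := exists_hitting hA hE (y := partialQV x τ N) (ε := ε)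
    (fun t => Finset.measurable_fun_sum _ fun n _ =>
      ((hx.stronglyAdapted_stoppedProcess (hτ.isStoppingTime (n + 1)) t).measurable.sub
        (hx.stronglyAdapted_stoppedProcess (hτ.isStoppingTime n) t).measurable).pow_const 2)
    (fun t ω h => by
      have hcap : ∀ n, ContinuousOn (fun s => x (cap s (τ n ω)) ω) (Iic t) := fun n =>
        (hc t ω h).comp (continuous_cap _).continuousOn fun s hs => (cap_le s _).trans hs
      exact continuousOn_finsetSum _ fun n _ => ((hcap (n + 1)).sub (hcap n)).pow 2)
    (fun ω _ => by simp [partialQV, zero_cap, hε.le])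
  obtain ⟨ρ₂, hρ₂, h₂, h₂'⟩ := exists_hitting hA hE (y := fun t ω => |x t ω|) (ε := K)
    (fun t => measurable_norm.comp (hxA t)) (fun t ω h => (hc t ω h).abs)
    (fun ω h => by simp [hx0 ω h, hK.le])
  obtain ⟨ρ, hρ, hρdef⟩ : ∃ ρ : Ω → WithTop ℝ≥0, IsStoppingTime ℱ ρ ∧
      ∀ ω, ρ ω = min (ρ₁ ω) (ρ₂ ω) := ⟨_, hρ₁.min hρ₂, fun _ => rfl⟩
  -- The right-hand side of the hedge grows by `2 * x` at `τ n` times the increment of `x`, so each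
  -- step is a single application of `Tradable`.
  have hsquare : ∀ n ≤ N, ∃ W F, NonnegSupermartingale ℱ S W ∧ InitiallyEnforceable ℱ S F ∧
      (∀ ω, W 0 ω = (ε : EReal)) ∧ ∀ t ω, (t, ω) ∈ F →
        ((ε + x (cap (cap t (ρ ω)) (τ n ω)) ω ^ 2 - partialQV x τ n (cap t (ρ ω)) ω : ℝ) : EReal) ≤
          W t ω := by
    intro n
    induction n with
    | zero =>
      refine fun _ => ⟨_, E, .const ℱ S j₀ hε.le, hE, fun _ => rfl, fun t ω h => ?_⟩
      rw [hτ.zero, cap_zero, hx0 ω (hE.initial bot_le h)]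
      simp [partialQV]
    | succ n ih =>
      intro hn
      obtain ⟨W, F, hW, hF, hW0, hWF⟩ := ih (by omega)
      -- Positions must be bounded; up to `ρ` the truncation at `K` is inactive.
      let v : Ω → ℝ := fun ω => 2 * max (-K) (min K (stoppedValue x (τ n) ω))
      have hv : Measurable[(hτ.isStoppingTime n).measurableSpace] v :=
        (measurable_const.max (measurable_const.min
          (measurable_stoppedValue hx (hτ.isStoppingTime n)))).const_mul 2
      have hvK : ∀ ω, |v ω| ≤ 2 * K := by
        intro ω
        rw [abs_mul, abs_two]
        refine mul_le_mul_of_nonneg_left (abs_le.2 ⟨le_max_left _ _, ?_⟩) zero_le_two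
        exact max_le (by linarith) (min_le_left _ _)
      have hgain : ∀ t ω, (t, ω) ∈ E →
          ({ω | τ n ω < ρ ω}.indicator v ω) * (x (cap t (min (τ (n + 1) ω) (ρ ω))) ω -
            x (cap t (min (τ n ω) (ρ ω))) ω) =
          2 * x (cap (cap t (ρ ω)) (τ n ω)) ω * (x (cap (cap t (ρ ω)) (τ (n + 1) ω)) ω -
            x (cap (cap t (ρ ω)) (τ n ω)) ω) := by
        intro t ω h
        rw [min_comm, ← cap_cap, min_comm, ← cap_cap]
        rcases le_or_gt (cap t (ρ ω) : WithTop ℝ≥0) (τ n ω) with h' | h'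
        · rw [cap_of_le h', cap_of_le (h'.trans (hτ.mono n ω))]
          ring
        · have hτρ : ω ∈ {ω | τ n ω < ρ ω} := h'.trans_le (coe_cap_le _ _)
          have hsv : stoppedValue x (τ n) ω = x (cap (cap t (ρ ω)) (τ n ω)) ω := by
            have := coe_cap_of_ge h'.le
            rw [stoppedValue]
            congr 1
            conv_lhs => rw [← this]
            rw [WithTop.untopA_eq_untop WithTop.coe_ne_top, WithTop.untop_coe]
          have hle : (cap (cap t (ρ ω)) (τ n ω) : WithTop ℝ≥0) ≤ ρ₂ ω :=
            (WithTop.coe_le_coe.2 (cap_le _ _)).trans ((coe_cap_le t (ρ ω)).trans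
              (by rw [hρdef]; exact min_le_right _ _))
          have habs := abs_le.1 (h₂ t ω h _ ((cap_le _ _).trans (cap_le _ _)) hle)
          rw [indicator_of_mem hτρ]
          simp only [v, hsv, min_eq_right habs.2, max_eq_right habs.1]
      have hkey : ∀ t ω, (t, ω) ∈ E ∩ F →
          ((ε + x (cap (cap t (ρ ω)) (τ (n + 1) ω)) ω ^ 2 -
            partialQV x τ (n + 1) (cap t (ρ ω)) ω : ℝ) : EReal) ≤
          W t ω + (({ω | τ n ω < ρ ω}.indicator v ω * (x (cap t (min (τ (n + 1) ω) (ρ ω))) ω -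
            x (cap t (min (τ n ω) (ρ ω))) ω) : ℝ) : EReal) := by
        intro t ω h
        rw [hgain t ω h.1]
        refine le_trans (le_of_eq ?_) (add_le_add_left (hWF t ω h.2) _)
        rw [← EReal.coe_add, partialQV, partialQV, Finset.sum_range_succ]
        congr 1
        ring
      obtain ⟨W', F', hW', hF', hW'0, hW'F⟩ := htr W hW _ _ ((hτ.isStoppingTime n).min hρ)
        ((hτ.isStoppingTime (n + 1)).min hρ) (fun ω => min_le_min_right _ (hτ.mono n ω))
        ({ω | τ n ω < ρ ω}.indicator v)
        (measurable_indicator_stopping_lt (hτ.isStoppingTime n) hρ hv) (2 * K)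
        (fun ω => by
          by_cases h : ω ∈ {ω | τ n ω < ρ ω}
          · rw [indicator_of_mem h]; exact hvK ω
          · rw [indicator_of_notMem h, abs_zero]; positivity)
        (E ∩ F) (hE.inter j₀ hF) fun t ω h => by
          -- Nonnegativity: the first `n + 1` squared increments sum to at most all `N` of them, and
          -- this is at most `ε` up to `ρ₁`.
          refine le_trans ?_ (hkey t ω h)
          have hle : (cap t (ρ ω) : WithTop ℝ≥0) ≤ ρ₁ ω :=
            (coe_cap_le t (ρ ω)).trans (by rw [hρdef]; exact min_le_left _ _)
          have hq := (partialQV_mono x τ hn (cap t (ρ ω)) ω).trans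
            (h₁ t ω h.1 _ (cap_le _ _) hle)
          have := sq_nonneg (x (cap (cap t (ρ ω)) (τ (n + 1) ω)) ω)
          exact EReal.coe_nonneg.2 (by linarith)
      exact ⟨W', F' ∩ (E ∩ F), hW', hF'.inter j₀ (hE.inter j₀ hF),
        fun ω => (hW'0 ω).trans (hW0 ω), fun t ω h => (hkey t ω h.2).trans (hW'F t ω h.1)⟩
  obtain ⟨W, F, hW, hF, hW0, hWF⟩ := hsquare N le_rfl
  refine ⟨W, F ∩ E, hW, hF.inter j₀ hE, hW0, fun t ω h htτ hqv hxK => ?_⟩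
  have htρ : (t : WithTop ℝ≥0) ≤ ρ ω := by
    rw [hρdef]
    exact le_min (h₁' t ω h.2 hqv).le (h₂' t ω h.2 hxK).le
  refine le_trans ?_ (hWF t ω h.1)
  rw [cap_of_le htρ, cap_of_le htτ]
  have := hqv t le_rfl
  exact_mod_cast (by linarith : x t ω ^ 2 ≤ ε + x t ω ^ 2 - partialQV x τ N t ω)

theorem IsCoverOn.exists_square_hedge (hA : AssumptionA ℱ S) (j₀ : Fin d) {E : Set (ℝ≥0 × Ω)}
    (hE : InitiallyEnforceable ℱ S E) {x : ℝ≥0 → Ω → ℝ} (hx : IsStronglyProgressive ℱ x)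
    (hc : ∀ t ω, (t, ω) ∈ E → ContinuousOn (fun s => x s ω) (Iic t)) (htr : Tradable ℱ S x)
    (hx0 : ∀ ω, (0, ω) ∈ E → x 0 ω = 0) {δ : ℝ} {τ : ℕ → Ω → WithTop ℝ≥0}
    (hτ : IsCoverOn ℱ E x δ τ) {ε : ℝ} (hε : 0 < ε) :
    ∃ W F, NonnegSupermartingale ℱ S W ∧ InitiallyEnforceable ℱ S F ∧
      (∀ ω, W 0 ω = (ε : EReal)) ∧ ∀ t ω, (t, ω) ∈ F →
        (∀ N, partialQV x τ N t ω + δ ^ 2 < ε) → ((x t ω ^ 2 : ℝ) : EReal) ≤ W t ω := by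
  -- Letting `K = N + 1` grow with `N` removes both restrictions in one liminf: eventually `τ N`
  -- passes `t` and `K` exceeds the bound of the path on `[0, t]`.
  choose W F hW hF hW0 hWF using fun N : ℕ => ModelFree.exists_square_hedge hA j₀ hE hx hc htr hx0
    hτ.toIsStoppingSequence hε (K := N + 1) (by positivity) N
  refine ⟨_, (⋂ N, F N) ∩ E, .liminf _ hW, (InitiallyEnforceable.iInter j₀ hF).inter j₀ hE,
    fun ω => ?_, fun t ω h hqv => ?_⟩
  · simp only [hW0, liminf_const]
  · have hcomp : IsCompact (Iic t) := by
      rw [← Icc_bot]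
      exact isCompact_Icc
    obtain ⟨B, hB⟩ := hcomp.exists_bound_of_continuousOn (hc t ω h.2)
    have hfin : ∀ᶠ N in atTop, (t : WithTop ℝ≥0) ≤ τ N ω := by
      have := (Nat.cofinite_eq_atTop ▸ (hτ.finite t ω h.2).eventually_cofinite_notMem :
        ∀ᶠ N in atTop, N ∉ {n | τ n ω ≤ (t : WithTop ℝ≥0)})
      filter_upwards [this] with N hN
      exact (not_le.1 hN).le
    refine le_liminf_of_le (by isBoundedDefault) ?_
    filter_upwards [hfin, eventually_ge_atTop ⌈B⌉₊] with N hN hBN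
    refine hWF N t ω (mem_iInter.1 h.1 N) hN (fun s hs => ?_) fun s hs => ?_
    · exact (hτ.partialQV_le hE hs h.2 N).trans_lt (hqv N)
    · have h1 : |x s ω| ≤ B := hB s hs
      have h2 : B ≤ N := (Nat.le_ceil B).trans (by exact_mod_cast hBN)
      linarith

/-- Where `Q` vanishes, the distance at time `t` is the simple quadratic variation itself, and this
dominates its partial sums. -/
theorem partialQV_lt {E : Set (ℝ≥0 × Ω)} (hE : InitiallyEnforceable ℱ S E)
    {X Q : ℝ≥0 → Ω → EReal} {x : ℝ≥0 → Ω → ℝ} (hXx : ∀ t ω, (t, ω) ∈ E → X t ω = x t ω)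
    {τ : ℕ → Ω → WithTop ℝ≥0} {t : ℝ≥0} {ω : Ω} (ht : (t, ω) ∈ E) (hQ : Q t ω = 0) {η : ℝ}
    (h : supDist (simpleQV X τ) Q (fun _ => True) t ω < ENNReal.ofReal η) (N : ℕ) :
    partialQV x τ N t ω < η := by
  have h1 : (simpleQV X τ t ω - Q t ω).abs ≤ supDist (simpleQV X τ) Q (fun _ => True) t ω :=
    le_iSup₂_of_le t le_rfl (le_iSup_of_le trivial le_rfl)
  rw [hQ, sub_zero] at h1
  have habs : ∀ a : ℝ≥0∞, (a : EReal).abs = a := by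
    intro a
    induction a with
    | top => simp
    | coe a =>
      have : ((a : ℝ≥0∞) : EReal) = ((a : ℝ) : EReal) := rfl
      rw [this, EReal.abs_def, NNReal.abs_eq, ENNReal.ofReal_coe_nnreal]
  rw [simpleQV, habs] at h1
  have h2 : ENNReal.ofReal (partialQV x τ N t ω) ≤ ∑' n, (stoppedProcess X (τ (n + 1)) t ω -
      stoppedProcess X (τ n) t ω).abs ^ 2 := by
    refine le_trans (le_of_eq ?_) (ENNReal.sum_le_tsum (Finset.range N))
    rw [partialQV, ENNReal.ofReal_sum_of_nonneg fun _ _ => sq_nonneg _]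
    refine Finset.sum_congr rfl fun n _ => ?_
    rw [stoppedProcess_apply, stoppedProcess_apply, hXx _ ω (hE.initial (cap_le _ _) ht),
      hXx _ ω (hE.initial (cap_le _ _) ht), ← EReal.coe_sub, EReal.abs_def,
      ← ENNReal.ofReal_pow (abs_nonneg _), sq_abs]
  exact (ENNReal.ofReal_lt_ofReal_iff_of_nonneg
    (Finset.sum_nonneg fun _ _ => sq_nonneg _)).1 ((h2.trans h1).trans_lt h)

/-! ### From cheap hedges to the theorem -/

/-- If nonnegative supermartingales with arbitrarily small initial capitals dominate a fixed
function, it vanishes with instant enforcement. -/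
theorem InstantlyEnforceable.of_hedges (j₀ : Fin d) {E : Set (ℝ≥0 × Ω)} {V : ℕ → ℝ≥0 → Ω → EReal}
    {f : ℝ≥0 → Ω → ℝ} (hV : ∀ j, NonnegSupermartingale ℱ S (V j))
    (hV0 : ∀ j ω, V j 0 ω = ((1 / ((j : ℝ) + 1) : ℝ) : EReal))
    (hE : InstantlyEnforceable ℱ S E) (hf : ∀ t ω, (t, ω) ∈ E → 0 ≤ f t ω)
    (hVf : ∀ j t ω, (t, ω) ∈ E → (f t ω : EReal) ≤ V j t ω) :
    InstantlyEnforceable ℱ S {q | q ∈ E ∧ f q.1 q.2 = 0} := by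
  have hj : ∀ j : ℕ, (0 : ℝ) ≤ (j : ℝ) + 1 := fun j => by positivity
  -- `(j + 1) * V j` starts at 1 and is at least `(j + 1) * f` on `E`, so its liminf is infinite
  -- where `f > 0`. Nothing is claimed off `E`, whence the implication.
  have hU : InstantlyEnforceable ℱ S {q | q ∈ E → f q.1 q.2 = 0} := by
    refine ⟨_, .liminf _ fun j => (hV j).const_mul j₀ (hj j), fun ω => ?_, fun t ω h => ?_⟩
    · have : ∀ j : ℕ, (((j : ℝ) + 1 : ℝ) : EReal) * V j 0 ω = 1 := by
        intro j
        rw [hV0, ← EReal.coe_mul, mul_one_div_cancel (by positivity), EReal.coe_one]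
      simp only [this, liminf_const]
    · simp only [mem_ofPred_eq, Classical.not_imp] at h
      have hpos : 0 < f t ω := lt_of_le_of_ne (hf t ω h.1) (Ne.symm h.2)
      have hlim : Tendsto (fun j : ℕ => ((((j : ℝ) + 1) * f t ω : ℝ) : EReal)) atTop (𝓝 ⊤) :=
        EReal.tendsto_coe_nhds_top_iff.2
          ((tendsto_atTop_add_const_right _ _ tendsto_natCast_atTop_atTop).atTop_mul_const hpos)
      rw [← top_le_iff, ← hlim.liminf_eq]
      refine liminf_le_liminf (Eventually.of_forall fun j => ?_)
      rw [EReal.coe_mul]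
      exact mul_le_mul_of_nonneg_left (hVf j t ω h.1) (EReal.coe_nonneg.2 (hj j))
  exact (hE.inter j₀ hU).mono fun q hq => ⟨hq.1, hq.2 hq.1⟩

end ModelFree

theorem mainTheorem11 {Ω : Type*} {m : MeasurableSpace Ω} (ℱ : Filtration ℝ≥0 m)
    (hℱ0 : ℱ 0 = ⊥) {d : ℕ} (S : Fin d → ℝ≥0 → Ω → ℝ)
    (hSadapted : ∀ j, Adapted ℱ (S j))
    (hScont : ∀ j ω, Continuous fun t => S j t ω)
    (hA : ModelFree.AssumptionA ℱ S)
    (X Q : ℝ≥0 → Ω → EReal)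
    (hX : ModelFree.IsMartingale ℱ S X)
    (hX0 : ∀ ω, X 0 ω = 0)
    (hQ : ModelFree.IsQuadraticVariation ℱ S X Q)
    (hQ0 : ModelFree.InstantlyEnforceable ℱ S {q | Q q.1 q.2 = 0}) :
    ModelFree.InstantlyEnforceable ℱ S {q | X q.1 q.2 = 0} := by
  open ModelFree in
  rcases isEmpty_or_nonempty Ω with _ | _
  · exact hQ0.mono fun q _ => isEmptyElim q.2
  obtain ⟨j₀⟩ := hQ0.exists_fin
  obtain ⟨x, E, hE, hx, hXE, htr⟩ := hX.exists_version hSadapted hScont hA j₀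
  have hc : ∀ t ω, (t, ω) ∈ E → ContinuousOn (fun s => x s ω) (Iic t) := fun t ω h =>
    (hXE t ω h).2
  have hXx : ∀ t ω, (t, ω) ∈ E → X t ω = x t ω := fun t ω h => (hXE t ω h).1
  have hx0 : ∀ ω, (0, ω) ∈ E → x 0 ω = 0 := fun ω h => by
    have := hXx 0 ω h
    rw [hX0] at this
    exact_mod_cast this.symm
  have hδ : ∀ k : ℕ, (0 : ℝ) < (1 / 2) ^ k := fun k => by positivity
  choose τ hτ using fun k => exists_cover hA hE hx hc (hδ k)
  have hconv := (hQ.tendsto (fun k => 2 * (1 / 2) ^ k) τ (fun k => mul_pos two_pos (hδ k))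
    (summable_geometric_two.mul_left 2) fun k => (hτ k).isFineCoverWIE hE hXx).2
  have hε : ∀ j : ℕ, (0 : ℝ) < 1 / ((j : ℝ) + 1) := fun j => by positivity
  choose W F hW hF hW0 hWF using fun j k =>
    (hτ k).exists_square_hedge hA j₀ hE hx hc htr hx0 (hε j)
  have hG := ((InitiallyEnforceable.iInter j₀ fun j => .iInter j₀ (hF j)).inter j₀ hE).enforceable
  -- For fixed capital `1 / (j + 1)`, the liminf over ever finer covers `k` hedges the square.
  refine (InstantlyEnforceable.of_hedges j₀ (V := fun j t ω => liminf (fun k => W j k t ω) atTop)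
    (f := fun t ω => x t ω ^ 2) (fun j => .liminf _ (hW j)) (fun j ω => ?_)
    (hG.inter j₀ (hconv.inter j₀ hQ0)) (fun _ _ _ => sq_nonneg _) fun j t ω h => ?_).mono ?_
  · simp only [hW0, liminf_const]
  · obtain ⟨⟨hFt, hEt⟩, hlim, hQt⟩ := h
    -- Half of the capital absorbs the squared increments at `t`, the other half the error from the
    -- unfinished increment at earlier times.
    have hη : 0 < 1 / ((j : ℝ) + 1) / 2 := half_pos (hε j)
    have hδ2 : Tendsto (fun k : ℕ => ((1 / 2 : ℝ) ^ k) ^ 2) atTop (𝓝 0) := by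
      simpa using (tendsto_pow_atTop_nhds_zero_of_lt_one (by norm_num : (0 : ℝ) ≤ 1 / 2)
        (by norm_num)).pow 2
    refine le_liminf_of_le (by isBoundedDefault) ?_
    filter_upwards [Tendsto.eventually hlim (gt_mem_nhds (ENNReal.ofReal_pos.2 hη)),
      hδ2.eventually (gt_mem_nhds hη)] with k hk hk2
    refine hWF j k t ω (mem_iInter.1 (mem_iInter.1 hFt j) k) fun N => ?_
    have := partialQV_lt hE hXx hEt hQt hk N
    linarith
  · rintro ⟨t, ω⟩ ⟨⟨⟨-, hEt⟩, -⟩, h⟩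
    have h0 : x t ω = 0 := by simpa using h
    have := hXx t ω hEt
    rw [h0] at this
    exact this
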